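/- **Setting.** Let $(\Omega,\mathcal F_\infty,(\mathcal F_t)_{t\ge 0},P)$ be a complete filtered probability space with right-continuous filtration, $\mathcal F_\infty=\bigvee_t\mathcal F_t$, and $\mathcal F_0$ generated by the $P$-null sets of $\mathcal F_\infty$. Stopping times take values in $[0,\infty]$ and $L^\infty(\mathcal F_\tau)=L^\infty(\Omega,\mathcal F_\tau,P)$; (in)equalities between random variables hold $P$-a.s. unless said otherwise. A *dynamic pricing procedure* is a family of maps $\Pi_{\sigma,\tau}:L^\infty(\mathcal F_\tau)\to L^\infty(\mathcal F_\sigma)$, for stopping times $\sigma\le\tau$, each of which is monotone, convex ($\Pi_{\sigma,\tau}(\lambda X+(1-\lambda)Y)\le\lambda\Pi_{\sigma,\tau}(X)+(1-\lambda)\Pi_{\sigma,\tau}(Y)$ for $\lambda\in[0,1]$), translation invariant ($\Pi_{\sigma,\tau}(X+Z)=\Pi_{\sigma,\tau}(X)+Z$ for $Z\in L^\infty(\mathcal F_\sigma)$) and normalized ($\Pi_{\sigma,\tau}(0)=0$). A *TCPP* is a dynamic pricing procedure that is time-consistent ($\Pi_{\nu,\sigma}(\Pi_{\sigma,\tau}(X))=\Pi_{\nu,\tau}(X)$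 for $\nu\le\sigma\le\tau$) and continuous from below (if $X_n\uparrow X$ a.s. in $L^\infty(\mathcal F_\tau)$, then $\Pi_{\sigma,\tau}(X_n)\to\Pi_{\sigma,\tau}(X)$ a.s.). It is *non degenerate* if, for $A\in\mathcal F_\infty$, $\Pi_{0,\infty}(\lambda 1_A)=0$ for all $\lambda>0$ implies $P(A)=0$. For a probability measure $R\ll P$ on $\mathcal F_\infty$, the minimal penalty is $$\alpha^m_{0,\tau}(R)=\sup_{X\in L^\infty(\mathcal F_\tau)}\bigl(E_R(X)-\Pi_{0,\tau}(X)\bigr)\in[0,\infty].$$ Let $(S^k)_{0\le k\le d}$ be real adapted processes with $S^0\equiv1$ and $S^1,\dots,S^d$ locally bounded. For a stopping time $\tau$, $S^k_\tau$ is understood on $\{\tau=\infty\}$ as $\lim_{t\to\infty}S^k_t$, and "$S^k_\tau\in L^\infty(\mathcal F_\tau)$" includes the a.s. existence of this limit there. Let $\tau_1,\dots,\tau_p$ be stopping times, $Y^l\in L^\infty(\mathcal F_{\tau_l})$, and let $C^l_{bid},C^l_{ask}$ be real numbers $(1\le l\le p)$. The TCPP is *strongly admissible* if * it extends the dynamics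 of $(S^k)$: $\Pi_{\sigma,\tau}(nS^k_\tau)=nS^k_\sigma$ for all $k$, all $n\in\mathbb Z$ and all stopping times $\sigma\le\tau$ with $S^k_\tau\in L^\infty(\mathcal F_\tau)$; * it is compatible with the observed prices: $C^l_{bid}\le-\Pi_{0,\tau_l}(-Y^l)\le\Pi_{0,\tau_l}(Y^l)\le C^l_{ask}$ for all $l$. **Proposition.** Consider, for a TCPP $(\Pi_{\sigma,\tau})$, the two conditions: 1. every probability measure $R\ll P$ with $\alpha^m_{0,\infty}(R)<\infty$ is a local martingale measure for the $S^k$, i.e. $E_R(S^k_\tau\mid\mathcal F_\sigma)=S^k_\sigma$ $R$-a.s. for all $k$ and all stopping times $\sigma\le\tau$ with $S^k_\tau\in L^\infty(\mathcal F_\tau)$; 2. for every probability measure $R\ll P$ and every stopping time $\tau$, $$\alpha^m_{0,\tau}(R)\ \ge\ \sup\Bigl(0,\ \sup_{\{l\,:\,\tau_l\le\tau\}}\max\bigl(C^l_{bid}-E_R(Y^l),\ E_R(Y^l)-C^l_{ask}\bigr)\Bigr).$$ If the TCPP is strongly admissible, then 1 and 2 hold. If moreover the TCPP is non degenerate, then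 it is strongly admissible if and only if 1 and 2 hold. -/

import Mathlib

open MeasureTheory ProbabilityTheory Filter Topology
open scoped NNReal ENNReal

/-- Usual assumptions on the filtered probability space `(Ω, F_∞, (F_t), P)`: right continuity,
completeness, `F_∞` is generated by the `F_t`, and `F_0` is generated by the `P`-null sets. -/
structure UsualAssumptions {Ω : Type*} {mΩ : MeasurableSpace Ω} (P : Measure Ω)
    (ℱ : Filtration ℝ≥0 mΩ) : Prop where
  rightContinuous : ℱ.IsRightContinuous
  complete : P.IsComplete
  iSup_eq : (⨆ t, ℱ t) = mΩ
  zero_eq : ℱ 0 = MeasurableSpace.generateFrom {s | MeasurableSet s ∧ P s = 0}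

/-- Stopping times with values in `[0, ∞]`, ordered pointwise. -/
abbrev StopTime {Ω : Type*} {mΩ : MeasurableSpace Ω} (ℱ : Filtration ℝ≥0 mΩ) : Type _ :=
  {τ : Ω → WithTop ℝ≥0 // IsStoppingTime ℱ τ}

namespace StopTime

/-- The stopping time `0`. -/
def zero {Ω : Type*} {mΩ : MeasurableSpace Ω} (ℱ : Filtration ℝ≥0 mΩ) : StopTime ℱ :=
  ⟨fun _ => ((0 : ℝ≥0) : WithTop ℝ≥0), isStoppingTime_const ℱ 0⟩

/-- The stopping time `∞`. -/
def infty {Ω : Type*} {mΩ : MeasurableSpace Ω} (ℱ : Filtration ℝ≥0 mΩ) : StopTime ℱ :=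
  ⟨fun _ => ⊤, fun i => by simp⟩

theorem zero_le {Ω : Type*} {mΩ : MeasurableSpace Ω} {ℱ : Filtration ℝ≥0 mΩ} (τ : StopTime ℱ) :
    zero ℱ ≤ τ := fun _ => bot_le

theorem le_infty {Ω : Type*} {mΩ : MeasurableSpace Ω} {ℱ : Filtration ℝ≥0 mΩ} (τ : StopTime ℱ) :
    τ ≤ infty ℱ := fun _ => le_top

end StopTime

/-- `L^∞(F_τ)`: the classes in `L^∞(Ω, F_∞, P)` having an `F_τ`-measurable representative. -/
noncomputable abbrev LInf {Ω : Type*} {mΩ : MeasurableSpace Ω} (P : Measure Ω)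
    {ℱ : Filtration ℝ≥0 mΩ} (τ : StopTime ℱ) : Submodule ℝ (Lp ℝ ∞ P) :=
  lpMeas ℝ ℝ τ.2.measurableSpace ∞ P

theorem LInf_mono {Ω : Type*} {mΩ : MeasurableSpace Ω} (P : Measure Ω)
    {ℱ : Filtration ℝ≥0 mΩ} {σ τ : StopTime ℱ} (h : σ ≤ τ) : LInf P σ ≤ LInf P τ := by
  intro X hX
  rw [mem_lpMeas_iff_aestronglyMeasurable] at hX ⊢
  exact hX.mono (IsStoppingTime.measurableSpace_mono σ.2 τ.2 h)

/-- The inclusion of `L^∞(F_σ)` in `L^∞(F_τ)` for `σ ≤ τ`. -/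
noncomputable def LInf.incl {Ω : Type*} {mΩ : MeasurableSpace Ω} {P : Measure Ω}
    {ℱ : Filtration ℝ≥0 mΩ} {σ τ : StopTime ℱ} (h : σ ≤ τ) : LInf P σ →ₗ[ℝ] LInf P τ :=
  Submodule.inclusion (LInf_mono P h)

/-- A dynamic pricing procedure `(Π_{σ,τ})_{0 ≤ σ ≤ τ}`; `price σ τ h X` is the ask price
`Π_{σ,τ}(X)`. Inequalities in `L^∞` are `P`-almost sure inequalities. -/
structure DynamicPricingProcedure {Ω : Type*} {mΩ : MeasurableSpace Ω} (P : Measure Ω)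
    (ℱ : Filtration ℝ≥0 mΩ) where
  price : ∀ σ τ : StopTime ℱ, σ ≤ τ → LInf P τ → LInf P σ
  monotone : ∀ (σ τ : StopTime ℱ) (h : σ ≤ τ) (X Y : LInf P τ),
    (X : Lp ℝ ∞ P) ≤ Y → (price σ τ h X : Lp ℝ ∞ P) ≤ price σ τ h Y
  translation : ∀ (σ τ : StopTime ℱ) (h : σ ≤ τ) (Z : LInf P σ) (X : LInf P τ),
    price σ τ h (X + LInf.incl h Z) = price σ τ h X + Z
  convex : ∀ (σ τ : StopTime ℱ) (h : σ ≤ τ) (X Y : LInf P τ) (r : ℝ), 0 ≤ r → r ≤ 1 →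
    (price σ τ h (r • X + (1 - r) • Y) : Lp ℝ ∞ P) ≤
      ((r • price σ τ h X + (1 - r) • price σ τ h Y : LInf P σ) : Lp ℝ ∞ P)
  normalized : ∀ (σ τ : StopTime ℱ) (h : σ ≤ τ), price σ τ h 0 = 0

/-- The value `X_τ` of a process at a stopping time; on `{τ = ∞}` it is `lim_{t → ∞} X_t`
(only used where this limit exists). -/
noncomputable def valueAt {Ω : Type*} {mΩ : MeasurableSpace Ω} {ℱ : Filtration ℝ≥0 mΩ}
    (X : ℝ≥0 → Ω → ℝ) (τ : StopTime ℱ) (ω : Ω) : ℝ :=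
  match τ.1 ω with
  | ⊤ => limUnder atTop (fun t : ℝ≥0 => X t ω)
  | (t : ℝ≥0) => X t ω

/-- `x` is the class of `X_τ` in `L^∞(F_τ)`. Thus `∃ x, IsBoundedValue X τ x` says that `X_τ` is
well defined almost surely and belongs to `L^∞(F_τ)`. -/
def IsBoundedValue {Ω : Type*} {mΩ : MeasurableSpace Ω} {P : Measure Ω} {ℱ : Filtration ℝ≥0 mΩ}
    (X : ℝ≥0 → Ω → ℝ) (τ : StopTime ℱ) (x : LInf P τ) : Prop :=
  (∀ᵐ ω ∂P, τ.1 ω = ⊤ → ∃ c : ℝ, Tendsto (fun t : ℝ≥0 => X t ω) atTop (𝓝 c)) ∧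
    (x : Lp ℝ ∞ P) =ᵐ[P] valueAt X τ

/-- Locally bounded processes: for stopping times `τ_n` increasing to `∞`, every stopped process
`X^{τ_n}` is uniformly bounded. -/
def IsLocallyBounded {Ω : Type*} {mΩ : MeasurableSpace Ω} (P : Measure Ω)
    (ℱ : Filtration ℝ≥0 mΩ) (X : ℝ≥0 → Ω → ℝ) : Prop :=
  ∃ τ : ℕ → Ω → WithTop ℝ≥0, IsLocalizingSequence ℱ τ P ∧
    ∀ n, ∃ C : ℝ, ∀ᵐ ω ∂P, ∀ t : ℝ≥0, abs (stoppedProcess X (τ n) t ω) ≤ C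

/-- The basic assets `(S^k)_{0 ≤ k ≤ d}`: adapted, `S^0 = 1` is the numéraire, and `S^1, …, S^d`
are locally bounded. -/
structure IsReferenceMarket {Ω : Type*} {mΩ : MeasurableSpace Ω} (P : Measure Ω)
    (ℱ : Filtration ℝ≥0 mΩ) {d : ℕ} (S : Fin (d + 1) → ℝ≥0 → Ω → ℝ) : Prop where
  adapted : ∀ k, Adapted ℱ (S k)
  numeraire : ∀ t ω, S 0 t ω = 1
  locallyBounded : ∀ k : Fin d, IsLocallyBounded P ℱ (S k.succ)

/-- `R` is a local martingale measure for `(S^k)`: `E_R(S^k_τ | F_σ) = S^k_σ` `R`-a.s. whenever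
`σ ≤ τ` and `S^k_τ ∈ L^∞(F_τ)`. -/
def IsLocalMartingaleMeasure {Ω : Type*} {mΩ : MeasurableSpace Ω} (P : Measure Ω)
    (ℱ : Filtration ℝ≥0 mΩ) {d : ℕ} (S : Fin (d + 1) → ℝ≥0 → Ω → ℝ) (R : Measure Ω) : Prop :=
  ∀ (k : Fin (d + 1)) (τ : StopTime ℱ), (∃ x : LInf P τ, IsBoundedValue (S k) τ x) →
    ∀ σ : StopTime ℱ, σ ≤ τ →
      R[valueAt (S k) τ | σ.2.measurableSpace] =ᵐ[R] valueAt (S k) σ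

namespace DynamicPricingProcedure

/-- Time consistency: `Π_{ν,σ}(Π_{σ,τ}(X)) = Π_{ν,τ}(X)`. -/
def IsTimeConsistent {Ω : Type*} {mΩ : MeasurableSpace Ω} {P : Measure Ω}
    {ℱ : Filtration ℝ≥0 mΩ} (Pi : DynamicPricingProcedure P ℱ) : Prop :=
  ∀ (ν σ τ : StopTime ℱ) (h₁ : ν ≤ σ) (h₂ : σ ≤ τ) (X : LInf P τ),
    Pi.price ν σ h₁ (Pi.price σ τ h₂ X) = Pi.price ν τ (h₁.trans h₂) X

/-- Continuity from below, with almost sure limits. -/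
def IsContinuousFromBelow {Ω : Type*} {mΩ : MeasurableSpace Ω} {P : Measure Ω}
    {ℱ : Filtration ℝ≥0 mΩ} (Pi : DynamicPricingProcedure P ℱ) : Prop :=
  ∀ (σ τ : StopTime ℱ) (h : σ ≤ τ) (X : ℕ → LInf P τ) (Y : LInf P τ),
    (∀ n, (X n : Lp ℝ ∞ P) ≤ X (n + 1)) →
    (∀ᵐ ω ∂P, Tendsto (fun n => (X n : Lp ℝ ∞ P) ω) atTop (𝓝 ((Y : Lp ℝ ∞ P) ω))) →
    ∀ᵐ ω ∂P, Tendsto (fun n => (Pi.price σ τ h (X n) : Lp ℝ ∞ P) ω) atTop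
      (𝓝 ((Pi.price σ τ h Y : Lp ℝ ∞ P) ω))

/-- A TCPP: a time-consistent dynamic pricing procedure continuous from below. -/
structure IsTCPP {Ω : Type*} {mΩ : MeasurableSpace Ω} {P : Measure Ω}
    {ℱ : Filtration ℝ≥0 mΩ} (Pi : DynamicPricingProcedure P ℱ) : Prop where
  timeConsistent : Pi.IsTimeConsistent
  continuousFromBelow : Pi.IsContinuousFromBelow

/-- Non degeneracy: for `A ∈ F_∞`, if `Π_{0,∞}(λ 1_A) = 0` for all `λ > 0` then `P(A) = 0`. -/
def IsNonDegenerate {Ω : Type*} {mΩ : MeasurableSpace Ω} {P : Measure Ω}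
    {ℱ : Filtration ℝ≥0 mΩ} (Pi : DynamicPricingProcedure P ℱ) : Prop :=
  ∀ A : Set Ω, MeasurableSet A →
    (∀ r : ℝ, 0 < r → ∀ X : LInf P (StopTime.infty ℱ),
      (X : Lp ℝ ∞ P) =ᵐ[P] A.indicator (fun _ => r) →
        Pi.price (StopTime.zero ℱ) (StopTime.infty ℱ) (StopTime.zero_le _) X = 0) →
    P A = 0

/-- The minimal penalty `α^m_{0,τ}(R) = sup_{X ∈ L^∞(F_τ)} (E_R(X) - Π_{0,τ}(X))`. As `F_0` is
trivial, `Π_{0,τ}(X)` is almost surely constant and is entered through its `R`-mean. -/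
noncomputable def minimalPenalty {Ω : Type*} {mΩ : MeasurableSpace Ω} {P : Measure Ω}
    {ℱ : Filtration ℝ≥0 mΩ} (Pi : DynamicPricingProcedure P ℱ) (τ : StopTime ℱ)
    (R : Measure Ω) : EReal :=
  ⨆ X : LInf P τ, (((∫ ω, (X : Lp ℝ ∞ P) ω ∂(R)) -
    ∫ ω, (Pi.price (StopTime.zero ℱ) τ (StopTime.zero_le τ) X : Lp ℝ ∞ P) ω ∂(R) : ℝ) : EReal)

/-- The pricing procedure extends the dynamics of `(S^k)`: `Π_{σ,τ}(n S^k_τ) = n S^k_σ` for all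
`n ∈ ℤ` and all `σ ≤ τ` such that `S^k_τ ∈ L^∞(F_τ)`. -/
def ExtendsDynamics {Ω : Type*} {mΩ : MeasurableSpace Ω} {P : Measure Ω}
    {ℱ : Filtration ℝ≥0 mΩ} (Pi : DynamicPricingProcedure P ℱ) {d : ℕ}
    (S : Fin (d + 1) → ℝ≥0 → Ω → ℝ) : Prop :=
  ∀ (k : Fin (d + 1)) (n : ℤ) (σ τ : StopTime ℱ) (h : σ ≤ τ) (x : LInf P τ),
    IsBoundedValue (S k) τ x →
      (Pi.price σ τ h ((n : ℝ) • x) : Lp ℝ ∞ P) =ᵐ[P] fun ω => (n : ℝ) * valueAt (S k) σ ω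

/-- Compatibility with the observed bid and ask prices of the options `Y^l` with maturities
`T l`: `C^l_bid ≤ -Π_{0,τ_l}(-Y^l) ≤ Π_{0,τ_l}(Y^l) ≤ C^l_ask`. -/
def IsCompatible {Ω : Type*} {mΩ : MeasurableSpace Ω} {P : Measure Ω}
    {ℱ : Filtration ℝ≥0 mΩ} (Pi : DynamicPricingProcedure P ℱ) {p : ℕ}
    (T : Fin p → StopTime ℱ) (Y : ∀ l, LInf P (T l)) (Cbid Cask : Fin p → ℝ) : Prop :=
  ∀ l, ∀ᵐ ω ∂P,
    Cbid l ≤ -(Pi.price (StopTime.zero ℱ) (T l) (StopTime.zero_le _) (-Y l) : Lp ℝ ∞ P) ω ∧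
    -(Pi.price (StopTime.zero ℱ) (T l) (StopTime.zero_le _) (-Y l) : Lp ℝ ∞ P) ω ≤
      (Pi.price (StopTime.zero ℱ) (T l) (StopTime.zero_le _) (Y l) : Lp ℝ ∞ P) ω ∧
    (Pi.price (StopTime.zero ℱ) (T l) (StopTime.zero_le _) (Y l) : Lp ℝ ∞ P) ω ≤ Cask l

/-- Strong admissibility with respect to the reference family and the observed prices. -/
structure IsStronglyAdmissible {Ω : Type*} {mΩ : MeasurableSpace Ω} {P : Measure Ω}
    {ℱ : Filtration ℝ≥0 mΩ} (Pi : DynamicPricingProcedure P ℱ) {d : ℕ}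
    (S : Fin (d + 1) → ℝ≥0 → Ω → ℝ) {p : ℕ} (T : Fin p → StopTime ℱ)
    (Y : ∀ l, LInf P (T l)) (Cbid Cask : Fin p → ℝ) : Prop where
  extendsDynamics : Pi.ExtendsDynamics S
  compatible : Pi.IsCompatible T Y Cbid Cask

/-- Every probability measure `R ≪ P` with `α^m_{0,∞}(R) < ∞` is a local martingale measure. -/
def FinitePenaltyLocalMartingale {Ω : Type*} {mΩ : MeasurableSpace Ω} {P : Measure Ω}
    {ℱ : Filtration ℝ≥0 mΩ} (Pi : DynamicPricingProcedure P ℱ) {d : ℕ}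
    (S : Fin (d + 1) → ℝ≥0 → Ω → ℝ) : Prop :=
  ∀ R : Measure Ω, IsProbabilityMeasure R → R ≪ P →
    Pi.minimalPenalty (StopTime.infty ℱ) R < ⊤ → IsLocalMartingaleMeasure P ℱ S R

/-- For every probability measure `R ≪ P` and every stopping time `τ`,
`α^m_{0,τ}(R) ≥ sup(0, sup_{l : τ_l ≤ τ} (C^l_bid - E_R(Y^l), E_R(Y^l) - C^l_ask))`. -/
def PenaltyLowerBound {Ω : Type*} {mΩ : MeasurableSpace Ω} {P : Measure Ω}
    {ℱ : Filtration ℝ≥0 mΩ} (Pi : DynamicPricingProcedure P ℱ) {p : ℕ}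
    (T : Fin p → StopTime ℱ) (Y : ∀ l, LInf P (T l)) (Cbid Cask : Fin p → ℝ) : Prop :=
  ∀ R : Measure Ω, IsProbabilityMeasure R → R ≪ P → ∀ τ : StopTime ℱ,
    max (0 : EReal) (⨆ l : Fin p, ⨆ _ : T l ≤ τ,
      ((max (Cbid l - ∫ ω, (Y l : Lp ℝ ∞ P) ω ∂(R))
        ((∫ ω, (Y l : Lp ℝ ∞ P) ω ∂(R)) - Cask l) : ℝ) : EReal)) ≤ Pi.minimalPenalty τ R

end DynamicPricingProcedure

/-! The engine is a dual bound for prices at time `0` (`exists_minimalPenalty_le`): if `c <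
Π_{0,τ}(X)`, some probability measure `R ≪ P` satisfies `α(R) ≤ E_R(X) - c`, where `α` is the
penalty at maturity `∞`. It comes from separating `0` from the convex upper set `{W | φ(X - W) ≤
c}`, with `φ = Π_{0,∞}`. Continuity from below closes this set under bounded almost sure limits. An
Orlicz type ball disjoint from it then yields a separating functional that is countably additive,
hence a measure.

Strong admissibility gives the two conditions by testing the penalty on particular claims. For `A ∈
F_σ`, locality and time consistency give price `0` to `n 1_A (S_τ - S_σ)` for every integer `n`, so
finite penalty forces `E_R(1_A (S_τ - S_σ)) = 0`. The claims `±Y^l` give the lower bound on the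
penalty.

Conversely, a violated quote `Π_{0,τ_l}(Y^l) > C^l_ask` would give, through the dual bound, a
measure whose penalty is below its required minimum; the bid is symmetric. For the dynamics, non
degeneracy and an exhaustion argument provide a measure of finite penalty equivalent to `P`, so that
`S_σ` is bounded `P`-a.s. The claims `c 1_A (S_τ - S_σ)` have mean `0` under every measure of finite
penalty, so the dual bound makes their initial price nonpositive. Non degeneracy then excludes
`Π_{σ,τ}(c (S_τ - S_σ)) > 0` on a non null set, and the signs `c = ±n` give equality. -/

/-! ### Almost minimal norm selections in inner product spaces. -/

/-- Nested nonempty bounded convex subsets of an inner product space contain a Cauchy selection. -/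
theorem exists_cauchySeq_mem_of_antitone_convex {H : Type*} [NormedAddCommGroup H]
    [InnerProductSpace ℝ H] {K : ℕ → Set H} (hanti : Antitone K) (hne : ∀ n, (K n).Nonempty)
    (hconv : ∀ n, Convex ℝ (K n)) {C : ℝ} (hC : ∀ n, ∀ x ∈ K n, ‖x‖ ≤ C) :
    ∃ x : ℕ → H, (∀ n, x n ∈ K n) ∧ CauchySeq x := by
  set d : ℕ → ℝ := fun n => sInf (norm '' K n) with hd
  have hbdd : ∀ n, BddBelow (norm '' K n) := fun n => ⟨0, by rintro _ ⟨x, -, rfl⟩; positivity⟩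
  have hle : ∀ n, ∀ x ∈ K n, d n ≤ ‖x‖ := fun n x hx => csInf_le (hbdd n) ⟨x, hx, rfl⟩
  have hd0 : ∀ n, 0 ≤ d n := fun n =>
    le_csInf ((hne n).image _) (by rintro _ ⟨x, -, rfl⟩; positivity)
  have hmono : Monotone d := fun n m h =>
    csInf_le_csInf (hbdd n) ((hne m).image _) (Set.image_mono (hanti h))
  have hdC : ∀ n, d n ≤ C := fun n => by
    obtain ⟨x, hx⟩ := hne n
    exact (hle n x hx).trans (hC n x hx)
  obtain ⟨D, hD⟩ : ∃ D, Tendsto d atTop (𝓝 D) :=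
    ⟨_, tendsto_atTop_ciSup hmono ⟨C, by rintro _ ⟨n, rfl⟩; exact hdC n⟩⟩
  have hdD : ∀ n, d n ≤ D := fun n => hmono.ge_of_tendsto hD n
  have hex : ∀ n : ℕ, ∃ x ∈ K n, ‖x‖ < d n + 1 / ((n : ℝ) + 1) := fun n => by
    obtain ⟨_, ⟨x, hx, rfl⟩, h⟩ := exists_lt_of_csInf_lt ((hne n).image norm)
      (show d n < d n + 1 / ((n : ℝ) + 1) from lt_add_of_pos_right _ (by positivity))
    exact ⟨x, hx, h⟩
  choose x hxK hx using hex
  refine ⟨x, hxK, cauchySeq_of_le_tendsto_0'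
    (fun n => √(4 * (D + 1 / ((n : ℝ) + 1)) ^ 2 - 4 * d n ^ 2)) ?_ ?_⟩
  · intro n m hnm
    -- The midpoint stays in `K n` because `K m ⊆ K n`. This lower bound, put into the parallelogram
    -- law, controls `‖x n - x m‖ ^ 2` by the expression under the root, which tends to `4 D² - 4 D²
    -- = 0`.
    have h1 : d n ≤ ‖(1 / 2 : ℝ) • x n + (1 / 2 : ℝ) • x m‖ :=
      hle n _ (hconv n (hxK n) (hanti hnm (hxK m)) (by norm_num) (by norm_num) (by norm_num))
    have h2 : ‖(1 / 2 : ℝ) • x n + (1 / 2 : ℝ) • x m‖ = 1 / 2 * ‖x n + x m‖ := by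
      rw [← smul_add, norm_smul]; norm_num
    have h3 := parallelogram_law_with_norm ℝ (x n) (x m)
    have h4 : 1 / ((m : ℝ) + 1) ≤ 1 / ((n : ℝ) + 1) :=
      one_div_le_one_div_of_le (by positivity) (by simpa using hnm)
    have h5 : ‖x n‖ ≤ D + 1 / ((n : ℝ) + 1) := (hx n).le.trans (by linarith [hdD n])
    have h6 : ‖x m‖ ≤ D + 1 / ((n : ℝ) + 1) := (hx m).le.trans (by linarith [hdD m])
    rw [dist_eq_norm]
    apply Real.le_sqrt_of_sq_le
    have h7 := mul_self_le_mul_self (norm_nonneg _) h5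
    have h8 := mul_self_le_mul_self (norm_nonneg _) h6
    have h9 := mul_self_le_mul_self (hd0 n) (h1.trans_eq h2)
    nlinarith
  · have : Tendsto (fun n : ℕ => √(4 * (D + 1 / ((n : ℝ) + 1)) ^ 2 - 4 * d n ^ 2)) atTop
        (𝓝 √(4 * (D + 0) ^ 2 - 4 * D ^ 2)) :=
      ((((tendsto_const_nhds.add tendsto_one_div_add_atTop_nhds_zero_nat).pow 2).const_mul 4).sub
        ((hD.pow 2).const_mul 4)).sqrt
    simpa using this

/-! ### Bounded almost sure convergence in `L^∞` and a compactness principle. -/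

section EssentiallyBounded

variable {Ω : Type*} {mΩ : MeasurableSpace Ω} {P : Measure Ω}

/-- Convergence of sequences in `L^∞`: uniformly bounded and almost sure. -/
def BoundedTendsto (V : ℕ → Lp ℝ ∞ P) (W : Lp ℝ ∞ P) : Prop :=
  (∃ C : ℝ, ∀ n, ‖V n‖ ≤ C) ∧ ∀ᵐ ω ∂P, Tendsto (fun n => V n ω) atTop (𝓝 (W ω))

theorem Lp.ae_abs_le_norm_top (W : Lp ℝ ∞ P) : ∀ᵐ ω ∂P, |W ω| ≤ ‖W‖ := by
  have h := ae_le_eLpNormEssSup (f := W) (μ := P)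
  filter_upwards [h] with ω hω
  rw [← eLpNorm_exponent_top] at hω
  have := ENNReal.toReal_mono (Lp.eLpNorm_ne_top W) hω
  simpa [Lp.norm_def] using this

variable [IsProbabilityMeasure P]

theorem Lp.norm_top_le_of_ae {W : Lp ℝ ∞ P} {C : ℝ} (hC : 0 ≤ C) (h : ∀ᵐ ω ∂P, |W ω| ≤ C) :
    ‖W‖ ≤ C := by
  have h' : ∀ᵐ ω ∂P, ‖W ω‖ ≤ C := h
  simpa using Lp.norm_le_of_ae_bound hC h'

theorem Lp.integrable_comp_top {θ : ℝ → ℝ} (hθ : Continuous θ) (W : Lp ℝ ∞ P) :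
    Integrable (fun ω => θ (W ω)) P := by
  obtain ⟨C, hC⟩ := (isCompact_Icc (a := -‖W‖) (b := ‖W‖)).exists_bound_of_continuousOn
    hθ.continuousOn
  refine Integrable.of_bound (hθ.comp_aestronglyMeasurable (Lp.aestronglyMeasurable W)) C ?_
  filter_upwards [Lp.ae_abs_le_norm_top W] with ω hω using hC _ (abs_le.1 hω)

theorem Lp.integrable_top (W : Lp ℝ ∞ P) : Integrable W P := Lp.integrable_comp_top continuous_id W

theorem BoundedTendsto.integral_comp {θ : ℝ → ℝ} (hθ : Continuous θ) {V : ℕ → Lp ℝ ∞ P}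
    {W : Lp ℝ ∞ P} (h : BoundedTendsto V W) :
    Tendsto (fun n => ∫ ω, θ (V n ω) ∂P) atTop (𝓝 (∫ ω, θ (W ω) ∂P)) := by
  obtain ⟨⟨C, hC⟩, hlim⟩ := h
  obtain ⟨B, hB⟩ := (isCompact_Icc (a := -C) (b := C)).exists_bound_of_continuousOn
    hθ.continuousOn
  refine tendsto_integral_of_dominated_convergence (fun _ => B)
    (fun n => (Lp.integrable_comp_top hθ (V n)).1) (integrable_const _) (fun n => ?_) ?_
  · filter_upwards [Lp.ae_abs_le_norm_top (V n)] with ω hω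
      using hB _ (abs_le.1 (hω.trans (hC n)))
  · filter_upwards [hlim] with ω hω using (hθ.tendsto _).comp hω

theorem Lp.integral_comp_convex {θ : ℝ → ℝ} (hθ : ConvexOn ℝ Set.univ θ) (hc : Continuous θ)
    (V W : Lp ℝ ∞ P) {a b : ℝ} (ha : 0 ≤ a) (hb : 0 ≤ b) (hab : a + b = 1) :
    ∫ ω, θ ((a • V + b • W : Lp ℝ ∞ P) ω) ∂P ≤
      a * ∫ ω, θ (V ω) ∂P + b * ∫ ω, θ (W ω) ∂P := by
  rw [← integral_const_mul, ← integral_const_mul, ← integral_add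
    ((Lp.integrable_comp_top hc V).const_mul a) ((Lp.integrable_comp_top hc W).const_mul b)]
  refine integral_mono_ae (Lp.integrable_comp_top hc _)
    (((Lp.integrable_comp_top hc V).const_mul a).add
      ((Lp.integrable_comp_top hc W).const_mul b)) ?_
  filter_upwards [Lp.coeFn_add (a • V) (b • W), Lp.coeFn_smul a V, Lp.coeFn_smul b W]
    with ω h1 h2 h3
  rw [h1, Pi.add_apply, h2, h3]
  exact hθ.2 trivial trivial ha hb hab

/-- A set of `L^∞` is boundedly closed if it is stable under bounded almost sure limits. -/
def BoundedlyClosed (E : Set (Lp ℝ ∞ P)) : Prop :=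
  ∀ (V : ℕ → Lp ℝ ∞ P) (W : Lp ℝ ∞ P), (∀ n, V n ∈ E) → BoundedTendsto V W → W ∈ E

theorem exists_mem_iInter_of_antitone_convex {K : ℕ → Set (Lp ℝ ∞ P)} (hanti : Antitone K)
    (hne : ∀ n, (K n).Nonempty) (hconv : ∀ n, Convex ℝ (K n)) {C : ℝ}
    (hC : ∀ n, ∀ x ∈ K n, ‖x‖ ≤ C) (hcl : ∀ n, BoundedlyClosed (K n)) :
    ∃ W, ∀ n, W ∈ K n := by
  have hmem : ∀ W : Lp ℝ ∞ P, MemLp W 2 P := fun W => (Lp.memLp W).mono_exponent le_top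
  let ι : Lp ℝ ∞ P →ₗ[ℝ] Lp ℝ 2 P :=
    { toFun := fun W => (hmem W).toLp
      map_add' := fun V W => by
        rw [← MemLp.toLp_add]
        exact MemLp.toLp_congr _ _ (Lp.coeFn_add V W)
      map_smul' := fun a W => by
        rw [RingHom.id_apply, ← MemLp.toLp_const_smul]
        exact MemLp.toLp_congr _ _ (Lp.coeFn_smul a W) }
  have hι : ∀ W, ι W =ᵐ[P] W := fun W => (hmem W).coeFn_toLp
  have hC0 : 0 ≤ C := by
    obtain ⟨x, hx⟩ := hne 0
    exact (norm_nonneg x).trans (hC 0 x hx)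
  obtain ⟨x, hxK, hx⟩ := exists_cauchySeq_mem_of_antitone_convex (K := fun n => ι '' K n)
    (fun n m h => Set.image_mono (hanti h)) (fun n => (hne n).image _)
    (fun n => (hconv n).linear_image ι) (C := C) (by
      rintro n _ ⟨W, hW, rfl⟩
      have : ∀ᵐ ω ∂P, ‖ι W ω‖ ≤ C := by
        filter_upwards [hι W, Lp.ae_abs_le_norm_top W] with ω h1 h2
        rw [h1]; exact h2.trans (hC n W hW)
      simpa [measureUnivNNReal] using Lp.norm_le_of_ae_bound hC0 this)
  choose V hVK hV using hxK
  obtain ⟨y, hy⟩ := cauchySeq_tendsto_of_complete hx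
  obtain ⟨ns, hns, hlim⟩ := (tendstoInMeasure_of_tendsto_Lp hy).exists_seq_tendsto_ae
  have hlim' : ∀ᵐ ω ∂P, Tendsto (fun i => V (ns i) ω) atTop (𝓝 (y ω)) := by
    have : ∀ᵐ ω ∂P, ∀ n, x n ω = V n ω := ae_all_iff.2 fun n => by
      rw [← hV n]; exact hι (V n)
    filter_upwards [hlim, this] with ω h1 h2
    simpa [h2] using h1
  have hyC : ∀ᵐ ω ∂P, ‖y ω‖ ≤ C := by
    have : ∀ᵐ ω ∂P, ∀ n, |V n ω| ≤ C := ae_all_iff.2 fun n => by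
      filter_upwards [Lp.ae_abs_le_norm_top (V n)] with ω h using h.trans (hC n _ (hVK n))
    filter_upwards [hlim', this] with ω h1 h2
    exact le_of_tendsto h1.norm (Eventually.of_forall fun i => h2 _)
  have hyL : MemLp y ∞ P := memLp_top_of_bound (Lp.aestronglyMeasurable y) C hyC
  -- The shift by `n` ensures `ns (i + n) ≥ n`, so the whole shifted sequence lies in `K n`.
  refine ⟨hyL.toLp, fun n => hcl n (fun i => V (ns (i + n))) _
    (fun i => hanti ((Nat.le_add_left n i).trans (hns.id_le _)) (hVK _))
    ⟨⟨C, fun i => hC _ _ (hVK _)⟩, ?_⟩⟩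
  filter_upwards [hlim', hyL.coeFn_toLp] with ω h1 h2
  rw [h2]
  exact h1.comp (tendsto_add_atTop_nat n)

end EssentiallyBounded

/-! ### Orlicz type balls and separation by boundedly continuous functionals. -/

section Separation

variable {Ω : Type*} {mΩ : MeasurableSpace Ω} {P : Measure Ω}

theorem convexOn_max_abs_sub (a : ℝ) : ConvexOn ℝ Set.univ fun x : ℝ => max (|x| - a) 0 :=
  ((convexOn_univ_norm (E := ℝ)).add_const (-a)).sup (convexOn_const 0 convex_univ)

theorem ConvexOn.continuous_real {θ : ℝ → ℝ} (hθ : ConvexOn ℝ Set.univ θ) : Continuous θ :=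
  continuousOn_univ.1 (hθ.continuousOn isOpen_univ)

variable [IsProbabilityMeasure P]

/-- If every coefficient `k` failed, the sets of counterexamples would decrease in `k` and share an
element `W` by compactness. Then `k` times the mean excess of `|W|` over `n` is at most `1` for all
`k`, so `|W| ≤ n`, contradicting `hn`. -/
theorem exists_penalty_coefficient {E : Set (Lp ℝ ∞ P)} (hconv : Convex ℝ E)
    (hcl : BoundedlyClosed E) {θ : ℝ → ℝ} (hθ : ConvexOn ℝ Set.univ θ) (hθ0 : ∀ x, 0 ≤ θ x)
    (n : ℕ) (hn : ∀ W ∈ E, (∀ᵐ ω ∂P, |W ω| ≤ n) → 1 < ∫ ω, θ (W ω) ∂P) :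
    ∃ c : ℝ, 0 ≤ c ∧ ∀ W ∈ E, (∀ᵐ ω ∂P, |W ω| ≤ (n + 1 : ℕ)) →
      1 < ∫ ω, (θ (W ω) + c * max (|W ω| - n) 0) ∂P := by
  by_contra! hcon
  have hψ (k : ℕ) : ConvexOn ℝ Set.univ fun x => θ x + (k : ℝ) * max (|x| - n) 0 :=
    hθ.add ((convexOn_max_abs_sub n).smul (Nat.cast_nonneg k))
  obtain ⟨W, hW⟩ := exists_mem_iInter_of_antitone_convex (P := P) (C := (n + 1 : ℕ))
    (K := fun k => {W | W ∈ E ∧ (∀ᵐ ω ∂P, |W ω| ≤ (n + 1 : ℕ)) ∧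
      ∫ ω, (θ (W ω) + (k : ℝ) * max (|W ω| - n) 0) ∂P ≤ 1})
    (by
      rintro k l hkl W ⟨h1, h2, h3⟩
      refine ⟨h1, h2, le_trans (integral_mono
        (Lp.integrable_comp_top (hψ k).continuous_real W)
        (Lp.integrable_comp_top (hψ l).continuous_real W) fun ω => ?_) h3⟩
      have : (k : ℝ) ≤ l := by exact_mod_cast hkl
      dsimp only
      gcongr)
    (fun k => by
      obtain ⟨W, h1, h2, h3⟩ := hcon k (Nat.cast_nonneg k)
      exact ⟨W, h1, h2, h3⟩)
    (by
      rintro k V ⟨h1, h2, h3⟩ W ⟨k1, k2, k3⟩ a b ha hb hab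
      refine ⟨hconv h1 k1 ha hb hab, ?_, ?_⟩
      · filter_upwards [Lp.coeFn_add (a • V) (b • W), Lp.coeFn_smul a V, Lp.coeFn_smul b W, h2, k2]
          with ω e1 e2 e3 l1 l2
        rw [e1, Pi.add_apply, e2, e3]
        have := (convexOn_univ_norm (E := ℝ)).2 (x := V ω) (y := W ω) trivial trivial ha hb hab
        refine this.trans ?_
        simp only [smul_eq_mul, Real.norm_eq_abs]
        calc a * |V ω| + b * |W ω| ≤ a * (n + 1 : ℕ) + b * (n + 1 : ℕ) := by gcongr
          _ = (n + 1 : ℕ) := by rw [← add_mul, hab, one_mul]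
      · refine (Lp.integral_comp_convex (hψ k) (hψ k).continuous_real V W ha hb hab).trans ?_
        calc _ ≤ a * 1 + b * 1 := by gcongr
          _ = 1 := by linarith)
    (fun k W hW => Lp.norm_top_le_of_ae (Nat.cast_nonneg _) hW.2.1)
    (fun k V W hV hVW => by
      refine ⟨hcl V W (fun i => (hV i).1) hVW, ?_, ?_⟩
      · have : ∀ᵐ ω ∂P, ∀ i, |V i ω| ≤ (n + 1 : ℕ) := ae_all_iff.2 fun i => (hV i).2.1
        filter_upwards [this, hVW.2] with ω h1 h2
        exact le_of_tendsto h2.abs (Eventually.of_forall h1)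
      · exact le_of_tendsto (hVW.integral_comp (hψ k).continuous_real)
          (Eventually.of_forall fun i => (hV i).2.2))
  have hint1 := Lp.integrable_comp_top hθ.continuous_real W
  have hint2 := Lp.integrable_comp_top (convexOn_max_abs_sub n).continuous_real W
  have hsplit (k : ℕ) : ∫ ω, θ (W ω) ∂P + k * ∫ ω, max (|W ω| - n) 0 ∂P ≤ 1 := by
    have := (hW k).2.2
    rwa [integral_add hint1 (hint2.const_mul _), integral_const_mul] at this
  have hnn : 0 ≤ ∫ ω, θ (W ω) ∂P := integral_nonneg fun ω => hθ0 _
  have hzero : ∫ ω, max (|W ω| - n) 0 ∂P = 0 := by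
    refine le_antisymm (not_lt.1 fun hpos => ?_) (integral_nonneg fun ω => le_max_right _ _)
    obtain ⟨k, hk⟩ := exists_nat_gt (1 / ∫ ω, max (|W ω| - n) 0 ∂P)
    rw [div_lt_iff₀ hpos] at hk
    linarith [hsplit k]
  have hWn : ∀ᵐ ω ∂P, |W ω| ≤ n := by
    have := (integral_eq_zero_iff_of_nonneg (fun ω => le_max_right _ _) hint2).1 hzero
    filter_upwards [this] with ω hω
    have : |W ω| - n ≤ 0 := max_eq_right_iff.1 hω
    linarith
  have h0 := hsplit 0
  rw [Nat.cast_zero, zero_mul, add_zero] at h0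
  exact absurd (hn W (hW 0).1 hWn) (not_lt.2 h0)

/-- A boundedly closed convex set of `L^∞` missing `0` misses an Orlicz type ball. -/
theorem exists_orlicz_function {E : Set (Lp ℝ ∞ P)} (hconv : Convex ℝ E)
    (hcl : BoundedlyClosed E) (h0 : (0 : Lp ℝ ∞ P) ∉ E) :
    ∃ θ : ℝ → ℝ, ConvexOn ℝ Set.univ θ ∧ θ 0 = 0 ∧ ∀ W ∈ E, 1 < ∫ ω, θ (W ω) ∂P := by
  -- Stage `n` deals with the elements of `E` bounded by `n`. Passing to the next stage alters `θ`
  -- only outside `[-n, n]`, so the stages glue to one convex function.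
  let Good (n : ℕ) (θ : ℝ → ℝ) : Prop := ConvexOn ℝ Set.univ θ ∧ (∀ x, 0 ≤ θ x) ∧ θ 0 = 0 ∧
    ∀ W ∈ E, (∀ᵐ ω ∂P, |W ω| ≤ n) → 1 < ∫ ω, θ (W ω) ∂P
  have hstep (n : ℕ) (θ : ℝ → ℝ) (h : Good n θ) : ∃ θ' : ℝ → ℝ, Good (n + 1) θ' ∧
      ∀ x : ℝ, |x| ≤ n → θ' x = θ x := by
    obtain ⟨h1, h2, h3, h4⟩ := h
    obtain ⟨c, hc, hc'⟩ := exists_penalty_coefficient hconv hcl h1 h2 n h4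
    refine ⟨fun x => θ x + c * max (|x| - n) 0, ⟨h1.add ((convexOn_max_abs_sub n).smul hc),
      fun x => add_nonneg (h2 x) (mul_nonneg hc (le_max_right _ _)), by simp [h3], hc'⟩, ?_⟩
    intro x hx
    simp [max_eq_right (sub_nonpos.2 hx)]
  -- Only `W = 0` is bounded by `0`, and it is not in `E`.
  have hbase : Good 0 (fun _ => 0) := by
    refine ⟨convexOn_const 0 convex_univ, fun _ => le_rfl, rfl, fun W hW h => absurd ?_ h0⟩
    have : W = 0 := by
      rw [Lp.eq_zero_iff_ae_eq_zero]
      filter_upwards [h] with ω hω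
      simpa using hω
    rwa [this] at hW
  choose! f hf hf' using hstep
  let Θ : ℕ → ℝ → ℝ := fun n => Nat.rec (fun _ => 0) (fun n θ => f n θ) n
  have hΘ (n : ℕ) : Good n (Θ n) := by
    induction n with
    | zero => exact hbase
    | succ n ih => exact hf n _ ih
  have heq (n m : ℕ) (hnm : n ≤ m) (x : ℝ) (hx : |x| ≤ n) : Θ m x = Θ n x := by
    induction m, hnm using Nat.le_induction with
    | base => rfl
    | succ m hm ih =>
      rw [← ih]
      exact hf' m _ (hΘ m) x (hx.trans (by exact_mod_cast hm))
  let θ : ℝ → ℝ := fun x => Θ ⌈|x|⌉₊ x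
  have hθ (n : ℕ) (x : ℝ) (hx : |x| ≤ n) : θ x = Θ n x :=
    (heq _ n (Nat.ceil_le.2 hx) x (Nat.le_ceil _)).symm
  refine ⟨θ, ⟨convex_univ, fun x _ y _ a b ha hb hab => ?_⟩, ?_, fun W hW => ?_⟩
  · obtain ⟨n, hn⟩ := exists_nat_ge (max |x| |y|)
    have hx := (le_max_left _ _).trans hn
    have hy := (le_max_right _ _).trans hn
    rw [hθ n x hx, hθ n y hy, hθ n]
    · exact (hΘ n).1.2 trivial trivial ha hb hab
    · refine ((convexOn_univ_norm (E := ℝ)).2 (x := x) (y := y) trivial trivial ha hb hab).trans ?_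
      simp only [smul_eq_mul, Real.norm_eq_abs]
      calc a * |x| + b * |y| ≤ a * n + b * n := by gcongr
        _ = n := by rw [← add_mul, hab, one_mul]
  · rw [hθ 0 0 (by simp)]
    exact (hΘ 0).2.2.1
  · obtain ⟨n, hn⟩ := exists_nat_ge ‖W‖
    have hWn : ∀ᵐ ω ∂P, |W ω| ≤ n := by
      filter_upwards [Lp.ae_abs_le_norm_top W] with ω hω using hω.trans hn
    rw [integral_congr_ae (g := fun ω => Θ n (W ω))
      (by filter_upwards [hWn] with ω hω using hθ n _ hω)]
    exact (hΘ n).2.2.2 W hW hWn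

/-- Separation of `0` from a boundedly closed convex set by a functional that is continuous along
bounded almost sure convergence. -/
theorem exists_boundedly_continuous_separating {E : Set (Lp ℝ ∞ P)} (hconv : Convex ℝ E)
    (hcl : BoundedlyClosed E) (hne : E.Nonempty) (h0 : (0 : Lp ℝ ∞ P) ∉ E) :
    ∃ (l : Lp ℝ ∞ P →L[ℝ] ℝ) (s : ℝ), 0 < s ∧ (∀ W ∈ E, s ≤ l W) ∧
      ∀ V : ℕ → Lp ℝ ∞ P, BoundedTendsto V 0 → Tendsto (fun n => l (V n)) atTop (𝓝 0) := by
  obtain ⟨θ, hθ, hθ0, hE⟩ := exists_orlicz_function hconv hcl h0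
  have hc := hθ.continuous_real
  set U : Set (Lp ℝ ∞ P) := {W | ∫ ω, θ (W ω) ∂P ≤ 1} with hU
  have hUconv : Convex ℝ U := by
    intro V hV W hW a b ha hb hab
    refine (Lp.integral_comp_convex hθ hc V W ha hb hab).trans ?_
    calc _ ≤ a * 1 + b * 1 := by gcongr <;> assumption
      _ = 1 := by linarith
  obtain ⟨δ, hδ, hδθ⟩ : ∃ δ > 0, ∀ x : ℝ, |x| ≤ δ → θ x ≤ 1 := by
    have : ∀ᶠ x in 𝓝 (0 : ℝ), θ x < 1 := hc.continuousAt.eventually_lt_const (by simp [hθ0])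
    obtain ⟨ε, hε, h⟩ := Metric.eventually_nhds_iff.1 this
    refine ⟨ε / 2, by positivity, fun x hx => (h ?_).le⟩
    rw [Real.dist_eq, sub_zero]
    linarith
  have hball : Metric.ball (0 : Lp ℝ ∞ P) δ ⊆ U := by
    intro W hW
    rw [mem_ball_zero_iff] at hW
    have : ∫ ω, θ (W ω) ∂P ≤ ∫ _, (1 : ℝ) ∂P :=
      integral_mono_ae (Lp.integrable_comp_top hc W) (integrable_const _) (by
        filter_upwards [Lp.ae_abs_le_norm_top W] with ω hω using hδθ _ (hω.trans hW.le))
    simpa [hU] using this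
  have hint : (0 : Lp ℝ ∞ P) ∈ interior U :=
    interior_maximal hball Metric.isOpen_ball (Metric.mem_ball_self hδ)
  have hdisj : Disjoint (interior U) E := by
    refine Set.disjoint_left.2 fun W hW hWE => ?_
    have hWU : W ∈ U := interior_subset hW
    exact absurd (hE W hWE) (not_lt.2 hWU)
  obtain ⟨l, s, hl, hlU, hlE⟩ :=
    geometric_hahn_banach_of_nonempty_interior hUconv hconv hdisj ⟨0, hint⟩ hne
  -- A nonzero `l` takes a positive value somewhere on the norm ball inside `U`, where `l ≤ s`.
  have hs : 0 < s := by
    obtain ⟨x, hx⟩ : ∃ x, l x ≠ 0 := by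
      by_contra! h
      exact hl (ContinuousLinearMap.ext h)
    have hx0 : 0 < ‖x‖ := norm_pos_iff.2 fun h => hx (by rw [h, map_zero])
    have hmem (r : ℝ) (hr : |r| = 1) : (r * (δ / 2 / ‖x‖)) • x ∈ U := hball (by
      rw [mem_ball_zero_iff, norm_smul, norm_mul, Real.norm_eq_abs r, hr, one_mul,
        Real.norm_of_nonneg (by positivity), div_mul_cancel₀ _ hx0.ne']
      linarith)
    have h1 := hlU _ (hmem 1 (by simp))
    have h2 := hlU _ (hmem (-1) (by simp))
    rw [map_smul, smul_eq_mul] at h1 h2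
    have h3 : 0 < |l x| := abs_pos.2 hx
    have h4 : 0 < δ / 2 / ‖x‖ := by positivity
    rcases abs_cases (l x) with ⟨h, -⟩ | ⟨h, -⟩ <;> rw [h] at h3 <;> nlinarith [mul_pos h4 h3]
  -- Along bounded convergence `∫ θ((s / ε) V n)` tends to `θ 0 = 0`, so `(s / ε) • V n` eventually
  -- lies in `U`, where `l ≤ s`.
  have hup (V : ℕ → Lp ℝ ∞ P) (hV : BoundedTendsto V 0) (ε : ℝ) (hε : 0 < ε) :
      ∀ᶠ n in atTop, l (V n) ≤ ε := by
    have hlim := hV.integral_comp (hc.comp (continuous_const_mul (s / ε)))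
    have hz : ∫ ω, (θ ∘ fun x => s / ε * x) ((0 : Lp ℝ ∞ P) ω) ∂P = 0 := by simp [hθ0]
    rw [hz] at hlim
    filter_upwards [hlim.eventually_le_const zero_lt_one] with n hn
    have : (s / ε) • V n ∈ U := by
      change ∫ ω, θ (((s / ε) • V n : Lp ℝ ∞ P) ω) ∂P ≤ 1
      refine le_trans (le_of_eq (integral_congr_ae ?_)) hn
      filter_upwards [Lp.coeFn_smul (s / ε) (V n)] with ω hω
      simp [hω]
    have h := hlU _ this
    rw [map_smul, smul_eq_mul, div_mul_eq_mul_div, div_le_iff₀ hε] at h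
    exact le_of_mul_le_mul_left h hs
  refine ⟨l, s, hs, hlE, fun V hV => ?_⟩
  have hV' : BoundedTendsto (fun n => -V n) 0 := by
    refine ⟨by simpa using hV.1, ?_⟩
    have : ∀ᵐ ω ∂P, ∀ n, (-V n : Lp ℝ ∞ P) ω = -V n ω := ae_all_iff.2 fun n => Lp.coeFn_neg (V n)
    filter_upwards [hV.2, this, Lp.coeFn_zero ℝ ∞ P] with ω h1 h2 h3
    simp only [h2]
    simpa [h3] using h1.neg
  rw [Metric.tendsto_atTop']
  intro ε hε
  have h1 := hup V hV (ε / 2) (by positivity)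
  have h2 := hup _ hV' (ε / 2) (by positivity)
  obtain ⟨N, hN⟩ := eventually_atTop.1 (h1.and h2)
  refine ⟨N, fun n hn => ?_⟩
  obtain ⟨h3, h4⟩ := hN n hn.le
  rw [map_neg] at h4
  rw [Real.dist_eq, sub_zero, abs_lt]
  constructor <;> linarith

end Separation

/-! ### From boundedly continuous functionals to measures, and the abstract dual bound. -/

section Representation

variable {Ω : Type*} {mΩ : MeasurableSpace Ω} {P : Measure Ω}

theorem integrable_of_ac {R : Measure Ω} [IsFiniteMeasure R] (hR : R ≪ P) (W : Lp ℝ ∞ P) :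
    Integrable W R :=
  Integrable.of_bound (Lp.stronglyMeasurable W).aestronglyMeasurable ‖W‖
    (hR.ae_le (Lp.ae_abs_le_norm_top W))

theorem integral_add_of_ac {R : Measure Ω} [IsFiniteMeasure R] (hR : R ≪ P) (V W : Lp ℝ ∞ P) :
    ∫ ω, (V + W : Lp ℝ ∞ P) ω ∂(R) = ∫ ω, V ω ∂(R) + ∫ ω, W ω ∂(R) := by
  rw [← integral_add (integrable_of_ac hR V) (integrable_of_ac hR W)]
  exact integral_congr_ae (hR.ae_le (Lp.coeFn_add V W))

theorem integral_sub_of_ac {R : Measure Ω} [IsFiniteMeasure R] (hR : R ≪ P) (V W : Lp ℝ ∞ P) :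
    ∫ ω, (V - W : Lp ℝ ∞ P) ω ∂(R) = ∫ ω, V ω ∂(R) - ∫ ω, W ω ∂(R) := by
  rw [← integral_sub (integrable_of_ac hR V) (integrable_of_ac hR W)]
  exact integral_congr_ae (hR.ae_le (Lp.coeFn_sub V W))

theorem integral_smul_of_ac {R : Measure Ω} (hR : R ≪ P) (a : ℝ) (W : Lp ℝ ∞ P) :
    ∫ ω, (a • W : Lp ℝ ∞ P) ω ∂(R) = a * ∫ ω, W ω ∂(R) := by
  rw [← integral_const_mul]
  exact integral_congr_ae (hR.ae_le (Lp.coeFn_smul a W))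

variable [IsProbabilityMeasure P]

/-- The class of an indicator function in `L^∞`. -/
noncomputable def indTop (P : Measure Ω) [IsProbabilityMeasure P] {A : Set Ω}
    (hA : MeasurableSet A) : Lp ℝ ∞ P :=
  indicatorConstLp ∞ hA (measure_ne_top P A) 1

theorem indTop_coe {A : Set Ω} (hA : MeasurableSet A) :
    indTop P hA =ᵐ[P] A.indicator fun _ => (1 : ℝ) := indicatorConstLp_coeFn

theorem indTop_nonneg {A : Set Ω} (hA : MeasurableSet A) : 0 ≤ indTop P hA := by
  rw [← Lp.coeFn_nonneg]
  filter_upwards [indTop_coe (P := P) hA] with ω h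
  rw [h]
  exact Set.indicator_nonneg (fun _ _ => zero_le_one) _

theorem norm_indTop_le {A : Set Ω} (hA : MeasurableSet A) : ‖indTop P hA‖ ≤ 1 := by
  refine Lp.norm_top_le_of_ae zero_le_one ?_
  filter_upwards [indTop_coe (P := P) hA] with ω h
  rw [h]
  by_cases hω : ω ∈ A <;> simp [hω]

theorem indTop_union {A B : Set Ω} (hA : MeasurableSet A) (hB : MeasurableSet B)
    (h : Disjoint A B) : indTop P (hA.union hB) = indTop P hA + indTop P hB :=
  indicatorConstLp_disjoint_union hA hB _ _ h 1

theorem indTop_empty : indTop P MeasurableSet.empty = 0 := indicatorConstLp_empty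

/-- A positive functional on `L^∞`, continuous along bounded almost sure convergence, is the
integral against a finite measure. -/
theorem exists_measure_of_boundedly_continuous (l : Lp ℝ ∞ P →L[ℝ] ℝ)
    (hpos : ∀ W, 0 ≤ W → 0 ≤ l W)
    (hcont : ∀ V : ℕ → Lp ℝ ∞ P, BoundedTendsto V 0 → Tendsto (fun n => l (V n)) atTop (𝓝 0)) :
    ∃ R : Measure Ω, IsFiniteMeasure R ∧ R ≪ P ∧ ∀ W : Lp ℝ ∞ P, l W = ∫ ω, W ω ∂(R) := by
  have hfin (f : ℕ → Set Ω) (hf : ∀ i, MeasurableSet (f i)) (hd : Pairwise (Function.onFun Disjoint f)) (n : ℕ) :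
      ∀ h : MeasurableSet (⋃ i ∈ Finset.range n, f i),
        ∑ i ∈ Finset.range n, l (indTop P (hf i)) = l (indTop P h) := by
    induction n with
    | zero => intro h; simp [indTop_empty]
    | succ n ih =>
      intro h
      have h' : MeasurableSet (⋃ i ∈ Finset.range n, f i) :=
        Finset.measurableSet_biUnion _ fun i _ => hf i
      have hdis : Disjoint (f n) (⋃ i ∈ Finset.range n, f i) := by
        rw [Set.disjoint_iUnion₂_right]
        intro i hi
        exact hd (by rw [Finset.mem_range] at hi; omega)
      have : indTop P h = indTop P ((hf n).union h') := by
        congr 1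
        rw [Finset.range_add_one, Finset.set_biUnion_insert]
      rw [Finset.sum_range_succ, ih h', this, indTop_union _ _ hdis, map_add, add_comm]
  let R : Measure Ω := Measure.ofMeasurable (fun A hA => ENNReal.ofReal (l (indTop P hA)))
    (by simp [indTop_empty]) (fun f hf hd => by
      have hU : MeasurableSet (⋃ i, f i) := MeasurableSet.iUnion hf
      have hUn (n : ℕ) : MeasurableSet (⋃ i ∈ Finset.range n, f i) :=
        Finset.measurableSet_biUnion _ fun i _ => hf i
      -- The indicators of the tails of the union tend to `0` boundedly; continuity of `l` along
      -- them is what makes the set function countably additive.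
      have hlim : BoundedTendsto (fun n => indTop P hU - indTop P (hUn n)) 0 := by
        refine ⟨⟨1 + 1, fun n => (norm_sub_le _ _).trans
          (add_le_add (norm_indTop_le _) (norm_indTop_le _))⟩, ?_⟩
        have h1 : ∀ᵐ ω ∂P, ∀ n, (indTop P hU - indTop P (hUn n) : Lp ℝ ∞ P) ω =
            (⋃ i, f i).indicator (fun _ => (1 : ℝ)) ω -
              (⋃ i ∈ Finset.range n, f i).indicator (fun _ => (1 : ℝ)) ω :=
          ae_all_iff.2 fun n => by
            filter_upwards [Lp.coeFn_sub (indTop P hU) (indTop P (hUn n)), indTop_coe (P := P) hU,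
              indTop_coe (P := P) (hUn n)] with ω e1 e2 e3
            rw [e1, Pi.sub_apply, e2, e3]
        filter_upwards [h1, Lp.coeFn_zero ℝ ∞ P] with ω e1 e2
        simp only [e1, e2]
        apply tendsto_const_nhds.congr'
        by_cases hω : ω ∈ ⋃ i, f i
        · obtain ⟨i, hi⟩ := Set.mem_iUnion.1 hω
          filter_upwards [eventually_gt_atTop i] with n hn
          rw [Set.indicator_of_mem hω, Set.indicator_of_mem, sub_self]
          · rfl
          · exact Set.mem_biUnion (Finset.mem_coe.2 (Finset.mem_range.2 hn)) hi
        · refine Eventually.of_forall fun n => ?_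
          beta_reduce
          rw [Set.indicator_of_notMem hω, Set.indicator_of_notMem, sub_self]
          · rfl
          · intro h
            obtain ⟨i, -, hi⟩ := Set.mem_iUnion₂.1 h
            exact hω (Set.mem_iUnion.2 ⟨i, hi⟩)
      have hsum : HasSum (fun i => l (indTop P (hf i))) (l (indTop P hU)) := by
        rw [hasSum_iff_tendsto_nat_of_nonneg fun i => hpos _ (indTop_nonneg _)]
        have := (tendsto_const_nhds (x := l (indTop P hU))).sub (hcont _ hlim)
        rw [sub_zero] at this
        refine this.congr fun n => ?_
        rw [hfin f hf hd n (hUn n), map_sub, sub_sub_cancel]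
      rw [← hsum.tsum_eq, ENNReal.ofReal_tsum_of_nonneg (fun i => hpos _ (indTop_nonneg _))
        hsum.summable])
  have hR (A : Set Ω) (hA : MeasurableSet A) : R A = ENNReal.ofReal (l (indTop P hA)) :=
    Measure.ofMeasurable_apply A hA
  have hRfin : IsFiniteMeasure R := ⟨by
    rw [hR _ MeasurableSet.univ]
    exact ENNReal.ofReal_lt_top⟩
  have hac : R ≪ P := Measure.AbsolutelyContinuous.mk fun A hA hPA => by
    have : indTop P hA = 0 := by
      rw [Lp.eq_zero_iff_ae_eq_zero]
      filter_upwards [indTop_coe (P := P) hA, measure_eq_zero_iff_ae_notMem.1 hPA] with ω h1 h2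
      rw [h1, Set.indicator_of_notMem h2]; rfl
    rw [hR A hA, this, map_zero, ENNReal.ofReal_zero]
  refine ⟨R, hRfin, hac, ?_⟩
  have hsimple (g : SimpleFunc Ω ℝ) : ∀ hg : MemLp g ∞ P, l hg.toLp = ∫ ω, g ω ∂(R) := by
    induction g using SimpleFunc.induction with
    | @const c A hA =>
      intro hg
      have h1 : hg.toLp = c • indTop P hA := by
        apply Lp.ext
        filter_upwards [hg.coeFn_toLp, Lp.coeFn_smul c (indTop P hA), indTop_coe (P := P) hA]
          with ω h1 h2 h3
        rw [h1, h2, Pi.smul_apply, h3]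
        by_cases hω : ω ∈ A <;> simp [hω]
      rw [h1, map_smul, smul_eq_mul]
      have h2 : ∫ ω, (SimpleFunc.piecewise A hA (SimpleFunc.const Ω c) (SimpleFunc.const Ω 0)) ω ∂(R)
          = ∫ ω, A.indicator (fun _ => c) ω ∂(R) := by
        congr 1
      rw [h2, integral_indicator_const c hA, measureReal_def, hR A hA,
        ENNReal.toReal_ofReal (hpos _ (indTop_nonneg _)), smul_eq_mul, mul_comm]
    | @add f g _ hf hg =>
      intro hfg
      have hf' : MemLp f ∞ P := f.memLp_top P
      have hg' : MemLp g ∞ P := g.memLp_top P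
      have : hfg.toLp = hf'.toLp + hg'.toLp := MemLp.toLp_add hf' hg'
      rw [this, map_add, hf hf', hg hg', ← integral_add]
      · rfl
      · exact f.integrable_of_isFiniteMeasure
      · exact g.integrable_of_isFiniteMeasure
  intro W
  have hWm := (Lp.stronglyMeasurable W).measurable
  have hWb := Lp.ae_abs_le_norm_top W
  let g : ℕ → SimpleFunc Ω ℝ := fun n => SimpleFunc.approxOn W hWm Set.univ 0 (Set.mem_univ 0) n
  have hg : ∀ n, MemLp (g n) ∞ P := fun n => (g n).memLp_top P
  have hglim (ω : Ω) : Tendsto (fun n => g n ω) atTop (𝓝 (W ω)) :=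
    SimpleFunc.tendsto_approxOn hWm (Set.mem_univ 0) (by simp)
  have hgb (n : ℕ) (ω : Ω) : ‖g n ω‖ ≤ ‖W ω‖ + ‖W ω‖ :=
    SimpleFunc.norm_approxOn_zero_le hWm (Set.mem_univ 0) ω n
  have hBT : BoundedTendsto (fun n => (hg n).toLp - W) 0 := by
    have hcoe : ∀ᵐ ω ∂P, ∀ n, ((hg n).toLp - W : Lp ℝ ∞ P) ω = g n ω - W ω :=
      ae_all_iff.2 fun n => by
        filter_upwards [Lp.coeFn_sub (hg n).toLp W, (hg n).coeFn_toLp] with ω h1 h2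
        rw [h1, Pi.sub_apply, h2]
    refine ⟨⟨‖W‖ + ‖W‖ + ‖W‖, fun n => Lp.norm_top_le_of_ae (by positivity) ?_⟩, ?_⟩
    · filter_upwards [hcoe, hWb] with ω h1 h2
      rw [h1]
      refine (abs_sub _ _).trans (add_le_add ((hgb n ω).trans ?_) h2)
      exact add_le_add h2 h2
    · filter_upwards [hcoe, Lp.coeFn_zero ℝ ∞ P] with ω h1 h2
      simp only [h1, h2]
      simpa using (hglim ω).sub_const (W ω)
  have h1 : Tendsto (fun n => ∫ ω, g n ω ∂(R)) atTop (𝓝 (l W)) := by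
    have := (hcont _ hBT).add_const (l W)
    simpa [hsimple] using this
  refine tendsto_nhds_unique h1 ?_
  refine tendsto_integral_of_dominated_convergence (fun _ => ‖W‖ + ‖W‖)
    (fun n => (g n).aestronglyMeasurable) (integrable_const _) (fun n => ?_)
    (Eventually.of_forall hglim)
  filter_upwards [hac.ae_le hWb] with ω h
  exact (hgb n ω).trans (add_le_add h h)

theorem integral_const_of_ac {R : Measure Ω} [IsProbabilityMeasure R] (hR : R ≪ P) (c : ℝ) :
    ∫ ω, Lp.const ∞ P c ω ∂(R) = c := by
  rw [integral_congr_ae (hR.ae_le (Lp.coeFn_const ∞ P c))]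
  simp

/-- A boundedly closed convex upper set of `L^∞` missing `0` lies in a half space given by an
absolutely continuous probability measure. -/
theorem exists_probabilityMeasure_separating {E : Set (Lp ℝ ∞ P)} (hconv : Convex ℝ E)
    (hcl : BoundedlyClosed E) (hup : IsUpperSet E) (hne : E.Nonempty)
    (h0 : (0 : Lp ℝ ∞ P) ∉ E) :
    ∃ R : Measure Ω, IsProbabilityMeasure R ∧ R ≪ P ∧ ∀ W ∈ E, 0 ≤ ∫ ω, W ω ∂(R) := by
  obtain ⟨l, s, hs, hlE, hlc⟩ := exists_boundedly_continuous_separating hconv hcl hne h0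
  obtain ⟨V, hV⟩ := hne
  -- `E` is an upper set, so `V + k • W` remains in it for all `k`; a negative `l W` would push `l`
  -- below its positive lower bound on `E`.
  have hpos (W : Lp ℝ ∞ P) (hW : 0 ≤ W) : 0 ≤ l W := by
    by_contra! hneg
    obtain ⟨k, hk⟩ := exists_nat_gt (l V / -l W)
    rw [div_lt_iff₀ (by linarith)] at hk
    have hkW : 0 ≤ (k : ℝ) • W := by
      rw [← Lp.coeFn_nonneg] at hW ⊢
      filter_upwards [hW, Lp.coeFn_smul (k : ℝ) W] with ω h1 h2
      rw [h2]
      exact mul_nonneg (Nat.cast_nonneg k) h1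
    have hmem : V + (k : ℝ) • W ∈ E := hup (le_add_of_nonneg_right hkW) hV
    have := hlE _ hmem
    rw [map_add, map_smul, smul_eq_mul] at this
    linarith
  obtain ⟨R, hRf, hRP, hR⟩ := exists_measure_of_boundedly_continuous l hpos hlc
  have hR0 : R ≠ 0 := by
    rintro rfl
    have := hlE V hV
    rw [hR V, integral_zero_measure] at this
    linarith
  have : NeZero R := ⟨hR0⟩
  refine ⟨(R Set.univ)⁻¹ • R, inferInstance, (Measure.smul_absolutelyContinuous).trans hRP,
    fun W hW => ?_⟩
  rw [integral_smul_measure, ← hR W]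
  exact smul_nonneg ENNReal.toReal_nonneg (hs.le.trans (hlE W hW))

/-- Dual lower bound for convex cash invariant functionals continuous from below. -/
theorem exists_probabilityMeasure_le {φ : Lp ℝ ∞ P → ℝ} (hmono : Monotone φ)
    (hconv : ConvexOn ℝ Set.univ φ) (htrans : ∀ X c, φ (X + Lp.const ∞ P c) = φ X + c)
    (hbelow : ∀ (X : ℕ → Lp ℝ ∞ P) (Y : Lp ℝ ∞ P), Monotone X →
      (∀ᵐ ω ∂P, Tendsto (fun n => X n ω) atTop (𝓝 (Y ω))) →
      Tendsto (fun n => φ (X n)) atTop (𝓝 (φ Y)))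
    (X : Lp ℝ ∞ P) {c : ℝ} (hc : c < φ X) :
    ∃ R : Measure Ω, IsProbabilityMeasure R ∧ R ≪ P ∧
      ∀ Y : Lp ℝ ∞ P, ∫ ω, Y ω ∂(R) - φ Y ≤ ∫ ω, X ω ∂(R) - c := by
  have hsep : ∃ R : Measure Ω, IsProbabilityMeasure R ∧ R ≪ P ∧
      ∀ W ∈ {W : Lp ℝ ∞ P | φ (X - W) ≤ c}, 0 ≤ ∫ ω, W ω ∂(R) := by
    refine exists_probabilityMeasure_separating ?_ ?_ ?_ ?_ ?_
    · intro V hV W hW a b ha hb hab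
      have : X - (a • V + b • W) = a • (X - V) + b • (X - W) := by
        rw [smul_sub, smul_sub, sub_add_sub_comm, ← add_smul, hab, one_smul]
      rw [Set.mem_ofPred_eq, this]
      refine (hconv.2 trivial trivial ha hb hab).trans ?_
      simp only [smul_eq_mul]
      rw [Set.mem_ofPred_eq] at hV hW
      calc _ ≤ a * c + b * c := by gcongr
        _ = c := by rw [← add_mul, hab, one_mul]
    · intro V W hV hVW
      obtain ⟨⟨C, hC⟩, hlim⟩ := hVW
      have hCb : ∀ᵐ ω ∂P, ∀ n, |V n ω| ≤ C := ae_all_iff.2 fun n => by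
        filter_upwards [Lp.ae_abs_le_norm_top (V n)] with ω h using h.trans (hC n)
      have hbd : ∀ᵐ ω ∂P, ∀ n, BddAbove (Set.range fun i => V (n + i) ω) := by
        filter_upwards [hCb] with ω h n
        exact ⟨C, by rintro _ ⟨i, rfl⟩; exact (abs_le.1 (h _)).2⟩
      -- The suprema `⨆ i, V (n + i)` decrease to `W`, so `X` minus them increases to `X - W` and
      -- continuity from below applies. Each supremum dominates `V n`, which keeps `φ` at most `c`.
      have hmeas (n : ℕ) : Measurable fun ω => ⨆ i, V (n + i) ω :=
        Measurable.iSup fun i => (Lp.stronglyMeasurable _).measurable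
      have hML (n : ℕ) : MemLp (fun ω => ⨆ i, V (n + i) ω) ∞ P := by
        refine memLp_top_of_bound (hmeas n).aestronglyMeasurable C ?_
        filter_upwards [hCb, hbd] with ω h h'
        rw [Real.norm_eq_abs, abs_le]
        exact ⟨(abs_le.1 (h (n + 0))).1.trans (le_ciSup (h' n) 0), ciSup_le fun i => (abs_le.1 (h _)).2⟩
      have hcoe : ∀ᵐ ω ∂P, ∀ n, (X - (hML n).toLp : Lp ℝ ∞ P) ω = X ω - ⨆ i, V (n + i) ω :=
        ae_all_iff.2 fun n => by
          filter_upwards [Lp.coeFn_sub X (hML n).toLp, (hML n).coeFn_toLp] with ω h1 h2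
          rw [h1, Pi.sub_apply, h2]
      refine le_of_tendsto (hbelow (fun n => X - (hML n).toLp) (X - W) ?_ ?_)
        (Eventually.of_forall fun n => ?_)
      · refine monotone_nat_of_le_succ fun n => ?_
        rw [← Lp.coeFn_le]
        filter_upwards [hcoe, hbd] with ω h1 h2
        rw [h1, h1]
        refine sub_le_sub_left (ciSup_le fun i => ?_) _
        have := le_ciSup (h2 n) (1 + i)
        simpa only [add_assoc] using this
      · filter_upwards [hcoe, hlim, Lp.coeFn_sub X W] with ω h1 h2 h3
        rw [h3, Pi.sub_apply]
        simp only [h1]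
        refine tendsto_const_nhds.sub ?_
        rw [Metric.tendsto_atTop] at h2 ⊢
        intro ε hε
        obtain ⟨N, hN⟩ := h2 (ε / 2) (by positivity)
        refine ⟨N, fun n hn => ?_⟩
        have hle (i : ℕ) : W ω - ε / 2 ≤ V (n + i) ω ∧ V (n + i) ω ≤ W ω + ε / 2 := by
          have := hN (n + i) (by omega)
          rw [Real.dist_eq, abs_lt] at this
          constructor <;> linarith
        have h4 : ⨆ i, V (n + i) ω ≤ W ω + ε / 2 := ciSup_le fun i => (hle i).2
        have h5 : W ω - ε / 2 ≤ ⨆ i, V (n + i) ω :=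
          (hle 0).1.trans (le_ciSup (f := fun i => V (n + i) ω)
            ⟨W ω + ε / 2, by rintro _ ⟨i, rfl⟩; exact (hle i).2⟩ 0)
        rw [Real.dist_eq, abs_lt]
        constructor <;> linarith
      · refine (hmono ?_).trans (hV n)
        rw [← Lp.coeFn_le]
        filter_upwards [hcoe, hbd, Lp.coeFn_sub X (V n)] with ω h1 h2 h3
        rw [h1, h3]
        exact sub_le_sub_left (le_ciSup (h2 n) 0) _
    · intro V W hVW hV
      exact (hmono (sub_le_sub_left hVW X)).trans hV
    · refine ⟨Lp.const ∞ P (φ X - c), ?_⟩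
      have := htrans (X - Lp.const ∞ P (φ X - c)) (φ X - c)
      rw [sub_add_cancel] at this
      rw [Set.mem_ofPred_eq]
      linarith
    · rw [Set.mem_ofPred_eq, sub_zero]
      exact not_le.2 hc
  obtain ⟨R, hR, hRP, hRE⟩ := hsep
  refine ⟨R, hR, hRP, fun Y => ?_⟩
  -- The constant `c - φ Y` shifts `Y` to price exactly `c`, which places this test element in the
  -- separated set.
  have h := hRE (X - (Y + Lp.const ∞ P (c - φ Y))) (by
    rw [Set.mem_ofPred_eq, sub_sub_cancel, htrans]
    linarith)
  rw [integral_sub_of_ac hRP, integral_add_of_ac hRP, integral_const_of_ac hRP] at h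
  linarith

end Representation

/-! ### Mixtures and exhaustion for families of absolutely continuous measures. -/

section Domination

variable {Ω : Type*} {mΩ : MeasurableSpace Ω} {P : Measure Ω}

/-- Countably many probability measures of finite penalty are dominated by a mixture of finite
penalty. -/
theorem exists_dominating_mixture (φ : Lp ℝ ∞ P → ℝ) (R : ℕ → Measure Ω)
    (hR : ∀ n, IsProbabilityMeasure (R n)) (hRP : ∀ n, R n ≪ P) (B : ℕ → ℝ)
    (hB : ∀ n Y, ∫ ω, Y ω ∂(R n) - φ Y ≤ B n) :
    ∃ Q : Measure Ω, IsProbabilityMeasure Q ∧ Q ≪ P ∧ (∀ n, R n ≪ Q) ∧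
      ∃ C : ℝ, ∀ Y, ∫ ω, Y ω ∂Q - φ Y ≤ C := by
  -- The geometric factors sum to `1`, and dividing by `1 + max (B n) 0` keeps `w n * B n` below
  -- them. After normalisation by `W = ∑ w n` the mixture has penalty at most `1 / W`.
  set w : ℕ → ℝ := fun n => 1 / 2 / 2 ^ n / (1 + max (B n) 0) with hw
  have hD (n : ℕ) : 1 ≤ 1 + max (B n) 0 := le_add_of_nonneg_right (le_max_right _ _)
  have hw0 (n : ℕ) : 0 < w n := div_pos (by positivity) (zero_lt_one.trans_le (hD n))
  have hgeo : HasSum (fun n : ℕ => (1 : ℝ) / 2 / 2 ^ n) 1 := hasSum_geometric_two' 1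
  have hwsum : Summable w := Summable.of_nonneg_of_le (fun n => (hw0 n).le)
    (fun n => div_le_self (by positivity) (hD n)) hgeo.summable
  have hwB (n : ℕ) : w n * B n ≤ 1 / 2 / 2 ^ n := by
    rw [hw]
    dsimp only
    rw [div_mul_eq_mul_div, div_le_iff₀ (zero_lt_one.trans_le (hD n))]
    gcongr
    exact (le_max_left _ _).trans (le_add_of_nonneg_left zero_le_one)
  set W := ∑' n, w n with hW
  have hW0 : 0 < W := hwsum.tsum_pos (fun n => (hw0 n).le) 0 (hw0 0)
  set q : ℕ → ℝ := fun n => w n / W with hq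
  have hq0 (n : ℕ) : 0 < q n := div_pos (hw0 n) hW0
  have hqsum : HasSum q 1 := by
    have := hwsum.hasSum.div_const W
    rwa [← hW, div_self hW0.ne'] at this
  let Q : Measure Ω := Measure.sum fun n => ENNReal.ofReal (q n) • R n
  have hQ : IsProbabilityMeasure Q := ⟨by
    rw [Measure.sum_apply _ MeasurableSet.univ]
    simp only [Measure.smul_apply, measure_univ, smul_eq_mul, mul_one]
    rw [← ENNReal.ofReal_tsum_of_nonneg (fun n => (hq0 n).le) hqsum.summable, hqsum.tsum_eq,
      ENNReal.ofReal_one]⟩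
  have hQP : Q ≪ P := Measure.absolutelyContinuous_sum_left fun n =>
    Measure.smul_absolutelyContinuous.trans (hRP n)
  refine ⟨Q, hQ, hQP, fun n => ?_, 1 / W, fun Y => ?_⟩
  · refine Measure.absolutelyContinuous_sum_right n ?_
    exact Measure.absolutelyContinuous_smul (by simpa using hq0 n)
  · have h1 : HasSum (fun n => q n * ∫ ω, Y ω ∂(R n)) (∫ ω, Y ω ∂Q) := by
      have := hasSum_integral_measure (integrable_of_ac hQP Y)
      simpa only [integral_smul_measure, ENNReal.toReal_ofReal (hq0 _).le, smul_eq_mul] using this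
    have h2 : HasSum (fun n => q n * φ Y) (φ Y) := by simpa using hqsum.mul_right (φ Y)
    refine hasSum_le (fun n => ?_) (h1.sub h2) (hgeo.div_const W)
    rw [← mul_sub]
    calc q n * (∫ ω, Y ω ∂(R n) - φ Y) ≤ q n * B n :=
          mul_le_mul_of_nonneg_left (hB n Y) (hq0 n).le
      _ = w n * B n / W := by rw [hq]; ring
      _ ≤ 1 / 2 / 2 ^ n / W := div_le_div_of_nonneg_right (hwB n) hW0.le

theorem measure_eq_zero_of_subset_rnDeriv_ne_zero {R : Measure Ω} [IsFiniteMeasure R]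
    [SigmaFinite P] (hRP : R ≪ P) {A : Set Ω} (hA : MeasurableSet A) (hRA : R A = 0) :
    P (A ∩ {ω | R.rnDeriv P ω ≠ 0}) = 0 := by
  rw [← Measure.withDensity_rnDeriv_eq R P hRP, withDensity_apply _ hA,
    lintegral_eq_zero_iff (Measure.measurable_rnDeriv R P), Filter.EventuallyEq,
    ae_restrict_iff' hA] at hRA
  rw [measure_eq_zero_iff_ae_notMem]
  filter_upwards [hRA] with ω h h'
  exact h'.2 (h h'.1)

theorem measure_rnDeriv_eq_zero {R : Measure Ω} [IsFiniteMeasure R] [SigmaFinite P]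
    (hRP : R ≪ P) : R {ω | R.rnDeriv P ω ≠ 0}ᶜ = 0 := by
  have hm : MeasurableSet {ω | R.rnDeriv P ω ≠ 0}ᶜ :=
    (Measure.measurable_rnDeriv R P (measurableSet_singleton 0).compl).compl
  have : (P.withDensity (R.rnDeriv P)) {ω | R.rnDeriv P ω ≠ 0}ᶜ = 0 := by
    rw [withDensity_apply _ hm, lintegral_eq_zero_iff (Measure.measurable_rnDeriv R P),
      Filter.EventuallyEq, ae_restrict_iff' hm]
    exact ae_of_all _ fun ω hω => not_not.1 hω
  rwa [Measure.withDensity_rnDeriv_eq R P hRP] at this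

variable [IsProbabilityMeasure P]

/-- Exhaustion: a family of probability measures in which sequences are dominated and which charges
every non null set has an equivalent member. -/
theorem exists_equivalent_of_dominating {F : Set (Measure Ω)}
    (hF : ∀ R ∈ F, IsProbabilityMeasure R ∧ R ≪ P)
    (hseq : ∀ R : ℕ → Measure Ω, (∀ n, R n ∈ F) → ∃ Q ∈ F, ∀ n, R n ≪ Q)
    (hch : ∀ A, MeasurableSet A → P A ≠ 0 → ∃ R ∈ F, R A ≠ 0) : ∃ Q ∈ F, P ≪ Q := by
  let supp (R : Measure Ω) : Set Ω := {ω | R.rnDeriv P ω ≠ 0}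
  have hsm (R : Measure Ω) : MeasurableSet (supp R) :=
    Measure.measurable_rnDeriv R P (measurableSet_singleton 0).compl
  have hdom (R Q : Measure Ω) (hR : R ∈ F) (hQ : Q ∈ F) (hRQ : R ≪ Q) :
      P (supp R \ supp Q) = 0 := by
    have := (hF R hR).1
    have := (hF Q hQ).1
    have h := measure_eq_zero_of_subset_rnDeriv_ne_zero (hF R hR).2 (hsm Q).compl
      (hRQ (measure_rnDeriv_eq_zero (hF Q hQ).2))
    rwa [Set.inter_comm] at h
  obtain ⟨R₀, hR₀, -⟩ := hch Set.univ MeasurableSet.univ (by simp)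
  obtain ⟨u, -, hu, huF⟩ := exists_seq_tendsto_sSup (S := (fun R => P (supp R)) '' F)
    ⟨_, R₀, hR₀, rfl⟩ (OrderTop.bddAbove _)
  choose R hRF hRu using huF
  obtain ⟨Q, hQF, hQ⟩ := hseq R hRF
  -- `Q` dominates a sequence whose supports have `P`-mass tending to the supremum over `F`, so its
  -- own support has maximal mass.
  have hmax (R' : Measure Ω) (hR' : R' ∈ F) : P (supp R') ≤ P (supp Q) := by
    have h1 : P (supp R') ≤ sSup ((fun R => P (supp R)) '' F) := le_sSup ⟨R', hR', rfl⟩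
    refine h1.trans (le_of_tendsto hu (Eventually.of_forall fun n => ?_))
    rw [← hRu n]
    exact measure_mono_ae (ae_le_set.2 (hdom _ _ (hRF n) hQF (hQ n)))
  refine ⟨Q, hQF, Measure.AbsolutelyContinuous.mk fun A hA hQA => ?_⟩
  by_contra hPA
  have := (hF Q hQF).1
  have hAQ := measure_eq_zero_of_subset_rnDeriv_ne_zero (hF Q hQF).2 hA hQA
  have hPA' : P (A \ supp Q) ≠ 0 := by
    intro h
    apply hPA
    rw [← Set.inter_union_sdiff A (supp Q)]
    exact measure_union_null hAQ h
  obtain ⟨R', hR', hR'A⟩ := hch _ (hA.diff (hsm Q)) hPA'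
  -- A member of `F` dominating both `Q` and `R'` has a support of strictly larger mass, since `R'`
  -- charges a set outside the support of `Q`.
  obtain ⟨Q', hQ', hdQ'⟩ := hseq (fun n => if n = 0 then Q else R') (fun n => by
    split_ifs <;> assumption)
  have hQQ' : Q ≪ Q' := by simpa using hdQ' 0
  have hRQ' : R' ≪ Q' := by simpa using hdQ' 1
  have := (hF R' hR').1
  have h1 : P (supp R' \ supp Q) ≠ 0 := by
    intro h
    apply hR'A
    have h2 := (hF R' hR').2 h
    have h3 := measure_rnDeriv_eq_zero (hF R' hR').2
    refine measure_mono_null ?_ (measure_union_null h2 h3)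
    intro ω hω
    by_cases h4 : ω ∈ supp R'
    · exact Or.inl ⟨h4, hω.2⟩
    · exact Or.inr h4
  have h2 : P (supp Q) + P (supp R' \ supp Q) ≤ P (supp Q) := by
    rw [← measure_union Set.disjoint_sdiff_right ((hsm R').diff (hsm Q))]
    refine le_trans (measure_mono_ae (ae_le_set.2 ?_)) (hmax Q' hQ')
    refine measure_mono_null ?_ (measure_union_null (hdom Q Q' hQF hQ' hQQ')
      (hdom R' Q' hR' hQ' hRQ'))
    rintro ω ⟨h | h, h'⟩
    · exact Or.inl ⟨h, h'⟩
    · exact Or.inr ⟨h.1, h'⟩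
  have h3 := (ENNReal.add_le_add_iff_left (measure_ne_top P (supp Q))).1
    (h2.trans_eq (add_zero _).symm)
  exact h1 (le_antisymm h3 zero_le)

end Domination

/-! ### Locality, prices at time `0`, and monotonicity and duality of the penalty. -/

section Pricing

variable {Ω : Type*} {mΩ : MeasurableSpace Ω} {P : Measure Ω} {ℱ : Filtration ℝ≥0 mΩ}

/-- The events `{∞ ≤ i}` are empty and the `F_t` generate `F_∞`, so nothing is lost at `∞`. Hence
`Π_{0,∞}` is defined on all of `L^∞`, as the duality requires. -/
theorem UsualAssumptions.mem_LInf_infty (hℱ : UsualAssumptions P ℱ) (X : Lp ℝ ∞ P) :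
    X ∈ LInf P (StopTime.infty ℱ) := by
  rw [mem_lpMeas_iff_aestronglyMeasurable]
  refine (Lp.aestronglyMeasurable X).mono fun s hs => ⟨hℱ.iSup_eq.symm.le s hs, fun i => ?_⟩
  have : s ∩ {ω | (StopTime.infty ℱ).1 ω ≤ i} = ∅ :=
    Set.eq_empty_of_forall_notMem fun ω h => by
      have h' : (⊤ : WithTop ℝ≥0) ≤ i := h.2
      exact absurd h' (not_le.2 (WithTop.coe_lt_top i))
  rw [this]
  exact @MeasurableSet.empty _ (ℱ i)

theorem LInf.exists_of_bound [IsProbabilityMeasure P] (τ : StopTime ℱ) {f : Ω → ℝ}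
    (hf : AEStronglyMeasurable[τ.2.measurableSpace] f P) {C : ℝ} (hC : ∀ᵐ ω ∂P, |f ω| ≤ C) :
    ∃ X : LInf P τ, (X : Lp ℝ ∞ P) =ᵐ[P] f := by
  have hL : MemLp f ∞ P := memLp_top_of_bound (hf.mono τ.2.measurableSpace_le) C hC
  refine ⟨⟨hL.toLp, ?_⟩, hL.coeFn_toLp⟩
  rw [mem_lpMeas_iff_aestronglyMeasurable]
  exact hf.congr hL.coeFn_toLp.symm

theorem LInf.exists_indicator [IsProbabilityMeasure P] {τ : StopTime ℱ} {A : Set Ω}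
    (hA : MeasurableSet[τ.2.measurableSpace] A) (X : LInf P τ) :
    ∃ Y : LInf P τ, (Y : Lp ℝ ∞ P) =ᵐ[P] A.indicator (X : Lp ℝ ∞ P) := by
  obtain ⟨g, hg, hXg⟩ := mem_lpMeas_iff_aestronglyMeasurable.1 X.2
  have hAX : A.indicator (X : Lp ℝ ∞ P) =ᵐ[P] A.indicator g := by
    filter_upwards [hXg] with ω hω
    by_cases h : ω ∈ A <;> simp [h, hω]
  refine LInf.exists_of_bound τ ⟨A.indicator g, hg.indicator hA, hAX⟩
    (C := ‖(X : Lp ℝ ∞ P)‖) ?_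
  filter_upwards [Lp.ae_abs_le_norm_top (X : Lp ℝ ∞ P)] with ω hω
  by_cases h : ω ∈ A
  · rwa [Set.indicator_of_mem h]
  · rw [Set.indicator_of_notMem h, abs_zero]
    exact norm_nonneg _

/-- The null or conull sets form a `σ`-algebra containing the generators of `F_0`. -/
theorem measure_zero_or_compl_zero (hℱ : UsualAssumptions P ℱ) {A : Set Ω}
    (hA : MeasurableSet[ℱ 0] A) : P A = 0 ∨ P Aᶜ = 0 := by
  rw [hℱ.zero_eq] at hA
  induction A, hA using MeasurableSpace.generateFrom_induction with
  | hC s hs _ => exact Or.inl hs.2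
  | empty => exact Or.inl measure_empty
  | compl s _ ih => rw [compl_compl]; exact ih.symm
  | iUnion s _ ih =>
    by_cases h : ∀ n, P (s n) = 0
    · exact Or.inl (measure_iUnion_null h)
    · push Not at h
      obtain ⟨n, hn⟩ := h
      exact Or.inr (measure_mono_null (Set.compl_subset_compl.2 (Set.subset_iUnion s n))
        ((ih n).resolve_left hn))

theorem LInf.eq_const_of_zero [IsProbabilityMeasure P] (hℱ : UsualAssumptions P ℱ)
    (X : LInf P (StopTime.zero ℱ)) :
    (X : Lp ℝ ∞ P) = Lp.const ∞ P (∫ ω, (X : Lp ℝ ∞ P) ω ∂P) := by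
  obtain ⟨g, hg, hXg⟩ := mem_lpMeas_iff_aestronglyMeasurable.1 X.2
  have hm : (StopTime.zero ℱ).2.measurableSpace = ℱ 0 := IsStoppingTime.measurableSpace_const ℱ 0
  rw [hm] at hg
  obtain ⟨c, hc⟩ := exists_eventuallyEq_const_of_forall_separating (l := ae P) (f := g)
    MeasurableSet (fun U hU => by
      rcases measure_zero_or_compl_zero hℱ (hg.measurable hU) with h | h
      · exact Or.inr (measure_eq_zero_iff_ae_notMem.1 h)
      · refine Or.inl ?_
        filter_upwards [measure_eq_zero_iff_ae_notMem.1 h] with ω hω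
        simpa using hω)
  have hXc := hXg.trans hc
  rw [integral_congr_ae hXc]
  apply Lp.ext
  filter_upwards [hXc, Lp.coeFn_const ∞ P (∫ _, c ∂P)] with ω h1 h2
  rw [h1]
  simp only [Function.const_apply] at h2 ⊢
  rw [h2]
  simp

namespace DynamicPricingProcedure

variable (Q : DynamicPricingProcedure P ℱ)

theorem price_incl {σ τ : StopTime ℱ} (h : σ ≤ τ) (Z : LInf P σ) :
    Q.price σ τ h (LInf.incl h Z) = Z := by
  have := Q.translation σ τ h Z 0
  rwa [Q.normalized, zero_add, zero_add] at this

/-- Adding `Z = ‖X - Y‖ 1_{Aᶜ}` to `Y` makes the inequality hold everywhere. As `Z` is known at `σ`,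
it leaves the price by translation invariance, and it vanishes on `A`. -/
theorem price_le_on [IsProbabilityMeasure P] {σ τ : StopTime ℱ} (h : σ ≤ τ) {A : Set Ω}
    (hA : MeasurableSet[σ.2.measurableSpace] A) {X Y : LInf P τ}
    (hXY : ∀ᵐ ω ∂P, ω ∈ A → (X : Lp ℝ ∞ P) ω ≤ (Y : Lp ℝ ∞ P) ω) :
    ∀ᵐ ω ∂P, ω ∈ A → (Q.price σ τ h X : Lp ℝ ∞ P) ω ≤ (Q.price σ τ h Y : Lp ℝ ∞ P) ω := by
  set C := ‖((X - Y : LInf P τ) : Lp ℝ ∞ P)‖ with hC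
  have hAc : StronglyMeasurable[σ.2.measurableSpace] (Aᶜ.indicator fun _ => C) :=
    stronglyMeasurable_const.indicator hA.compl
  obtain ⟨Z, hZ⟩ := LInf.exists_of_bound (P := P) σ (C := C) hAc.aestronglyMeasurable (ae_of_all _ fun ω => by
        by_cases hω : ω ∈ Aᶜ
        · rw [Set.indicator_of_mem hω, abs_of_nonneg (norm_nonneg _)]
        · rw [Set.indicator_of_notMem hω, abs_zero]; exact norm_nonneg _)
  have hle : (X : Lp ℝ ∞ P) ≤ (Y + LInf.incl h Z : LInf P τ) := by
    rw [← Lp.coeFn_le]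
    have h1 : ((Y + LInf.incl h Z : LInf P τ) : Lp ℝ ∞ P) = (Y : Lp ℝ ∞ P) + (Z : Lp ℝ ∞ P) := rfl
    have h2 : ((X - Y : LInf P τ) : Lp ℝ ∞ P) = (X : Lp ℝ ∞ P) - (Y : Lp ℝ ∞ P) := rfl
    rw [h1]
    rw [h2] at hC
    filter_upwards [Lp.coeFn_add (Y : Lp ℝ ∞ P) (Z : Lp ℝ ∞ P), hZ, hXY,
      Lp.coeFn_sub (X : Lp ℝ ∞ P) (Y : Lp ℝ ∞ P),
      Lp.ae_abs_le_norm_top ((X : Lp ℝ ∞ P) - (Y : Lp ℝ ∞ P))] with ω e1 e2 e3 e4 e5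
    rw [e1, Pi.add_apply, e2]
    by_cases hω : ω ∈ A
    · rw [Set.indicator_of_notMem (by simpa using hω), add_zero]
      exact e3 hω
    · rw [Set.indicator_of_mem (by simpa using hω), hC]
      rw [e4, Pi.sub_apply] at e5
      linarith [le_abs_self ((X : Lp ℝ ∞ P) ω - (Y : Lp ℝ ∞ P) ω)]
  have hmono := Q.monotone σ τ h _ _ hle
  rw [Q.translation, ← Lp.coeFn_le] at hmono
  filter_upwards [hmono, hZ, Lp.coeFn_add (Q.price σ τ h Y : Lp ℝ ∞ P) (Z : Lp ℝ ∞ P)]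
    with ω e1 e2 e3 hω
  refine e1.trans ?_
  change ((Q.price σ τ h Y : Lp ℝ ∞ P) + (Z : Lp ℝ ∞ P) : Lp ℝ ∞ P) ω ≤ _
  rw [e3, Pi.add_apply, e2, Set.indicator_of_notMem (by simpa using hω), add_zero]

/-- Locality of pricing procedures. -/
theorem price_indicator [IsProbabilityMeasure P] {σ τ : StopTime ℱ} (h : σ ≤ τ) {A : Set Ω}
    (hA : MeasurableSet[σ.2.measurableSpace] A) {X X' : LInf P τ}
    (hX : (X' : Lp ℝ ∞ P) =ᵐ[P] A.indicator (X : Lp ℝ ∞ P)) :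
    (Q.price σ τ h X' : Lp ℝ ∞ P) =ᵐ[P] A.indicator (Q.price σ τ h X : Lp ℝ ∞ P) := by
  have h0 := Q.normalized σ τ h
  have e0 : ((0 : LInf P τ) : Lp ℝ ∞ P) =ᵐ[P] 0 := Lp.coeFn_zero ℝ ∞ P
  have e0' : (Q.price σ τ h 0 : Lp ℝ ∞ P) =ᵐ[P] 0 := by
    rw [h0]; exact Lp.coeFn_zero ℝ ∞ P
  have h1 := Q.price_le_on h hA (X := X) (Y := X') (by
    filter_upwards [hX] with ω e hω
    rw [e, Set.indicator_of_mem hω])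
  have h2 := Q.price_le_on h hA (X := X') (Y := X) (by
    filter_upwards [hX] with ω e hω
    rw [e, Set.indicator_of_mem hω])
  have h3 := Q.price_le_on h hA.compl (X := X') (Y := 0) (by
    filter_upwards [hX, e0] with ω e e' hω
    rw [e, e', Set.indicator_of_notMem hω]; rfl)
  have h4 := Q.price_le_on h hA.compl (X := 0) (Y := X') (by
    filter_upwards [hX, e0] with ω e e' hω
    rw [e, e', Set.indicator_of_notMem hω]; rfl)
  filter_upwards [h1, h2, h3, h4, e0'] with ω k1 k2 k3 k4 k5
  by_cases hω : ω ∈ A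
  · rw [Set.indicator_of_mem hω]
    exact le_antisymm (k2 hω) (k1 hω)
  · rw [Set.indicator_of_notMem hω]
    rw [k5] at k3 k4
    exact le_antisymm (k3 hω) (k4 hω)

/-- The almost sure value of the price at time `0`. -/
noncomputable def initialPrice (τ : StopTime ℱ) (X : LInf P τ) : ℝ :=
  ∫ ω, (Q.price (StopTime.zero ℱ) τ (StopTime.zero_le τ) X : Lp ℝ ∞ P) ω ∂P

variable {Q}

theorem initialPrice_price (hPi : Q.IsTCPP) {σ τ : StopTime ℱ} (h : σ ≤ τ) (X : LInf P τ) :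
    Q.initialPrice σ (Q.price σ τ h X) = Q.initialPrice τ X := by
  unfold initialPrice
  rw [hPi.timeConsistent]

/-- The initial price of a claim does not depend on the maturity assigned to it. -/
theorem initialPrice_incl (hPi : Q.IsTCPP) {σ τ : StopTime ℱ} (h : σ ≤ τ) (X : LInf P σ) :
    Q.initialPrice τ (LInf.incl h X) = Q.initialPrice σ X := by
  rw [← initialPrice_price hPi h, Q.price_incl]

theorem initialPrice_zero (τ : StopTime ℱ) : Q.initialPrice τ 0 = 0 := by
  unfold initialPrice
  rw [Q.normalized]
  exact integral_eq_zero_of_ae (Lp.coeFn_zero ℝ ∞ P)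

variable [IsProbabilityMeasure P]

theorem price_zero_eq_const (hℱ : UsualAssumptions P ℱ) (τ : StopTime ℱ) (X : LInf P τ) :
    (Q.price (StopTime.zero ℱ) τ (StopTime.zero_le τ) X : Lp ℝ ∞ P) =
      Lp.const ∞ P (Q.initialPrice τ X) := LInf.eq_const_of_zero hℱ _

theorem price_zero_ae (hℱ : UsualAssumptions P ℱ) (τ : StopTime ℱ) (X : LInf P τ) :
    ∀ᵐ ω ∂P, (Q.price (StopTime.zero ℱ) τ (StopTime.zero_le τ) X : Lp ℝ ∞ P) ω =
      Q.initialPrice τ X := by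
  rw [price_zero_eq_const hℱ]
  exact Lp.coeFn_const ∞ P _

theorem minimalPenalty_eq (hℱ : UsualAssumptions P ℱ) (τ : StopTime ℱ) {R : Measure Ω}
    [IsProbabilityMeasure R] (hR : R ≪ P) :
    Q.minimalPenalty τ R =
      ⨆ X : LInf P τ, (((∫ ω, (X : Lp ℝ ∞ P) ω ∂(R)) - Q.initialPrice τ X : ℝ) : EReal) := by
  unfold minimalPenalty
  congr! 5 with X
  rw [price_zero_eq_const hℱ, integral_const_of_ac hR]

theorem le_minimalPenalty (hℱ : UsualAssumptions P ℱ) (τ : StopTime ℱ) {R : Measure Ω}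
    [IsProbabilityMeasure R] (hR : R ≪ P) (X : LInf P τ) :
    (((∫ ω, (X : Lp ℝ ∞ P) ω ∂(R)) - Q.initialPrice τ X : ℝ) : EReal) ≤
      Q.minimalPenalty τ R := by
  rw [minimalPenalty_eq hℱ τ hR]
  exact le_iSup (fun X : LInf P τ =>
    (((∫ ω, (X : Lp ℝ ∞ P) ω ∂(R)) - Q.initialPrice τ X : ℝ) : EReal)) X

/-- A later maturity offers more test claims, and the earlier ones keep their initial price. -/
theorem minimalPenalty_mono (hℱ : UsualAssumptions P ℱ) (hPi : Q.IsTCPP) {σ τ : StopTime ℱ}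
    (h : σ ≤ τ) {R : Measure Ω} [IsProbabilityMeasure R] (hR : R ≪ P) :
    Q.minimalPenalty σ R ≤ Q.minimalPenalty τ R := by
  rw [minimalPenalty_eq hℱ σ hR]
  refine iSup_le fun X => ?_
  have := le_minimalPenalty (Q := Q) hℱ τ hR (LInf.incl h X)
  rwa [initialPrice_incl hPi] at this

theorem exists_bound_of_minimalPenalty_lt_top (hℱ : UsualAssumptions P ℱ) (hPi : Q.IsTCPP)
    {R : Measure Ω} [IsProbabilityMeasure R] (hR : R ≪ P)
    (hfin : Q.minimalPenalty (StopTime.infty ℱ) R < ⊤) :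
    ∃ B : ℝ, ∀ (τ : StopTime ℱ) (X : LInf P τ),
      ∫ ω, (X : Lp ℝ ∞ P) ω ∂(R) - Q.initialPrice τ X ≤ B := by
  obtain ⟨B, hB⟩ := EReal.lt_iff_exists_real_btwn.1 hfin
  refine ⟨B, fun τ X => ?_⟩
  have h := ((le_minimalPenalty hℱ τ hR X).trans
    (minimalPenalty_mono hℱ hPi (StopTime.le_infty τ) hR)).trans hB.1.le
  exact_mod_cast h

theorem initialPrice_mono {τ : StopTime ℱ} {X Y : LInf P τ}
    (h : (X : Lp ℝ ∞ P) ≤ Y) : Q.initialPrice τ X ≤ Q.initialPrice τ Y := by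
  have := Q.monotone _ τ (StopTime.zero_le τ) X Y h
  exact integral_mono_ae (Lp.integrable_top _) (Lp.integrable_top _) ((Lp.coeFn_le _ _).2 this)

/-- Dual lower bound for the price at time `0`. -/
theorem exists_minimalPenalty_le (hℱ : UsualAssumptions P ℱ) (hPi : Q.IsTCPP)
    {τ : StopTime ℱ} (X : LInf P τ) {c : ℝ} (hc : c < Q.initialPrice τ X) :
    ∃ R : Measure Ω, IsProbabilityMeasure R ∧ R ≪ P ∧
      Q.minimalPenalty (StopTime.infty ℱ) R ≤ ((∫ ω, (X : Lp ℝ ∞ P) ω ∂(R) - c : ℝ) : EReal) := by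
  have hz := StopTime.zero_le (StopTime.infty ℱ)
  let up (W : Lp ℝ ∞ P) : LInf P (StopTime.infty ℱ) := ⟨W, hℱ.mem_LInf_infty W⟩
  obtain ⟨R, hR, hRP, h⟩ := exists_probabilityMeasure_le
    (φ := fun W => Q.initialPrice (StopTime.infty ℱ) (up W))
    (fun V W hVW => initialPrice_mono hVW)
    ⟨convex_univ, fun V _ W _ a b ha hb hab => by
      obtain rfl : b = 1 - a := by linarith
      have := Q.convex _ _ hz (up V) (up W) a ha (by linarith)
      rw [← Lp.coeFn_le] at this
      refine (integral_mono_ae (Lp.integrable_top _) (Lp.integrable_top _) this).trans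
        (le_of_eq ?_)
      change ∫ ω, (a • (Q.price _ _ hz (up V) : Lp ℝ ∞ P) +
        (1 - a) • (Q.price _ _ hz (up W) : Lp ℝ ∞ P) : Lp ℝ ∞ P) ω ∂P = _
      rw [integral_add_of_ac Measure.AbsolutelyContinuous.rfl,
        integral_smul_of_ac Measure.AbsolutelyContinuous.rfl,
        integral_smul_of_ac Measure.AbsolutelyContinuous.rfl]
      rfl⟩
    (fun W r => by
      have hcm : Lp.const ∞ P r ∈ LInf P (StopTime.zero ℱ) := by
        rw [mem_lpMeas_iff_aestronglyMeasurable]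
        exact (aestronglyMeasurable_const (b := r)).congr (Lp.coeFn_const ∞ P r).symm
      have h1 := Q.translation _ _ hz ⟨_, hcm⟩ (up W)
      have h2 : up (W + Lp.const ∞ P r) = up W + LInf.incl hz ⟨_, hcm⟩ := rfl
      unfold initialPrice
      rw [h2, h1]
      change ∫ ω, ((Q.price _ _ hz (up W) : Lp ℝ ∞ P) + Lp.const ∞ P r : Lp ℝ ∞ P) ω ∂P = _
      rw [integral_add_of_ac Measure.AbsolutelyContinuous.rfl,
        integral_const_of_ac Measure.AbsolutelyContinuous.rfl])
    (fun V W hV hlim => by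
      have h1 := hPi.continuousFromBelow _ _ hz (fun n => up (V n)) (up W)
        (fun n => hV (Nat.le_succ n)) hlim
      have h2 : ∀ᵐ ω ∂P, ∀ n, (Q.price _ _ hz (up (V n)) : Lp ℝ ∞ P) ω =
          Q.initialPrice _ (up (V n)) := ae_all_iff.2 fun n => price_zero_ae hℱ _ _
      -- Prices at time `0` are almost surely constant, so one good `ω` turns almost sure
      -- convergence into convergence of numbers.
      obtain ⟨ω, k1, k2, k3⟩ := (h1.and (h2.and (price_zero_ae hℱ _ (up W)))).exists
      rw [k3] at k1
      simpa only [k2] using k1)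
    (X : Lp ℝ ∞ P) (c := c) (by
      rwa [← initialPrice_incl hPi (StopTime.le_infty τ)] at hc)
  refine ⟨R, hR, hRP, ?_⟩
  rw [minimalPenalty_eq hℱ _ hRP]
  refine iSup_le fun Y => ?_
  exact_mod_cast h (Y : Lp ℝ ∞ P)

end DynamicPricingProcedure

end Pricing

/-! ### The two implications between strong admissibility and the conditions on the penalty. -/

section Admissibility

variable {Ω : Type*} {mΩ : MeasurableSpace Ω} {P : Measure Ω} {ℱ : Filtration ℝ≥0 mΩ}

theorem eq_zero_of_forall_int_mul_le {t B : ℝ} (h : ∀ n : ℤ, (n : ℝ) * t ≤ B) : t = 0 := by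
  by_contra ht
  obtain ⟨n, hn⟩ := exists_nat_gt (B / |t|)
  rw [div_lt_iff₀ (abs_pos.2 ht)] at hn
  rcases abs_cases t with ⟨e, -⟩ | ⟨e, -⟩ <;> rw [e] at hn
  · have := h n
    push_cast at this
    linarith
  · have := h (-n)
    push_cast at this
    linarith

namespace DynamicPricingProcedure

variable {Q : DynamicPricingProcedure P ℱ}

theorem price_smul_sub {σ τ : StopTime ℱ} (h : σ ≤ τ) (c : ℝ) (x : LInf P τ) (y : LInf P σ) :
    Q.price σ τ h (c • (x - LInf.incl h y)) = Q.price σ τ h (c • x) - c • y := by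
  have := Q.translation σ τ h (c • y) (c • (x - LInf.incl h y))
  rw [map_smul, ← smul_add, sub_add_cancel] at this
  rw [this, add_sub_cancel_right]

/-- By convexity, since `0` is the midpoint of `W` and `-W` and has price `0`. -/
theorem neg_price_neg_le {σ τ : StopTime ℱ} (h : σ ≤ τ) (W : LInf P τ) :
    ∀ᵐ ω ∂P, -(Q.price σ τ h (-W) : Lp ℝ ∞ P) ω ≤ (Q.price σ τ h W : Lp ℝ ∞ P) ω := by
  have h1 := Q.convex σ τ h W (-W) (1 / 2) (by norm_num) (by norm_num)
  have h2 : (1 / 2 : ℝ) • W + (1 - 1 / 2 : ℝ) • -W = 0 := by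
    rw [smul_neg, ← sub_eq_add_neg, ← sub_smul]
    norm_num
  rw [h2, Q.normalized, ← Lp.coeFn_le] at h1
  filter_upwards [h1, Lp.coeFn_zero ℝ ∞ P,
    Lp.coeFn_add ((1 / 2 : ℝ) • (Q.price σ τ h W : Lp ℝ ∞ P))
      ((1 - 1 / 2 : ℝ) • (Q.price σ τ h (-W) : Lp ℝ ∞ P)),
    Lp.coeFn_smul (1 / 2 : ℝ) (Q.price σ τ h W : Lp ℝ ∞ P),
    Lp.coeFn_smul (1 - 1 / 2 : ℝ) (Q.price σ τ h (-W) : Lp ℝ ∞ P)] with ω e1 e2 e3 e4 e5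
  change ((0 : Lp ℝ ∞ P) : Ω → ℝ) ω ≤ ((1 / 2 : ℝ) • (Q.price σ τ h W : Lp ℝ ∞ P) +
      (1 - 1 / 2 : ℝ) • (Q.price σ τ h (-W) : Lp ℝ ∞ P) : Lp ℝ ∞ P) ω at e1
  rw [e2, e3, _root_.Pi.add_apply, e4, e5] at e1
  simp only [_root_.Pi.zero_apply, _root_.Pi.smul_apply, smul_eq_mul] at e1
  linarith

/-- By convexity, since `W` is the combination of `a • W` and `0` with weight `a⁻¹` on the former.
-/
theorem mul_price_le {σ τ : StopTime ℱ} (h : σ ≤ τ) (W : LInf P τ) {a : ℝ} (ha : 1 ≤ a) :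
    ∀ᵐ ω ∂P, a * (Q.price σ τ h W : Lp ℝ ∞ P) ω ≤ (Q.price σ τ h (a • W) : Lp ℝ ∞ P) ω := by
  have ha0 : 0 < a := zero_lt_one.trans_le ha
  have h1 := Q.convex σ τ h (a • W) 0 a⁻¹ (by positivity) (inv_le_one_of_one_le₀ ha)
  rw [Q.normalized, smul_zero, smul_zero, add_zero, add_zero, smul_smul, inv_mul_cancel₀ ha0.ne',
    one_smul, ← Lp.coeFn_le] at h1
  filter_upwards [h1, Lp.coeFn_smul a⁻¹ (Q.price σ τ h (a • W) : Lp ℝ ∞ P)] with ω e1 e2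
  change _ ≤ (a⁻¹ • (Q.price σ τ h (a • W) : Lp ℝ ∞ P) : Lp ℝ ∞ P) ω at e1
  rw [e2, _root_.Pi.smul_apply, smul_eq_mul, inv_mul_eq_div, le_div_iff₀ ha0] at e1
  linarith

theorem integral_indicator_smul_sub {R : Measure Ω} [IsProbabilityMeasure R] (hR : R ≪ P)
    {σ τ : StopTime ℱ} (h : σ ≤ τ) {A : Set Ω} (hA : MeasurableSet A) (c : ℝ) {x W : LInf P τ}
    {y : LInf P σ}
    (hW : (W : Lp ℝ ∞ P) =ᵐ[P]
      A.indicator ((c • (x - LInf.incl h y) : LInf P τ) : Lp ℝ ∞ P)) :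
    ∫ ω, (W : Lp ℝ ∞ P) ω ∂(R) =
      c * (∫ ω in A, (x : Lp ℝ ∞ P) ω ∂(R) - ∫ ω in A, (y : Lp ℝ ∞ P) ω ∂(R)) := by
  rw [integral_congr_ae (hR.ae_le hW), integral_indicator hA,
    ← integral_sub (integrable_of_ac hR _).integrableOn (integrable_of_ac hR _).integrableOn,
    ← integral_const_mul]
  refine integral_congr_ae (ae_restrict_of_ae (hR.ae_le ?_))
  filter_upwards [Lp.coeFn_smul c ((x : Lp ℝ ∞ P) - (y : Lp ℝ ∞ P)),
    Lp.coeFn_sub (x : Lp ℝ ∞ P) (y : Lp ℝ ∞ P)] with ω e1 e2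
  change (c • ((x : Lp ℝ ∞ P) - (y : Lp ℝ ∞ P)) : Lp ℝ ∞ P) ω = _
  rw [e1, _root_.Pi.smul_apply, e2, _root_.Pi.sub_apply, smul_eq_mul]

theorem integral_neg_of_ac {R : Measure Ω} (hR : R ≪ P) {τ : StopTime ℱ} (W : LInf P τ) :
    ∫ ω, ((-W : LInf P τ) : Lp ℝ ∞ P) ω ∂(R) = -∫ ω, (W : Lp ℝ ∞ P) ω ∂(R) := by
  rw [← integral_neg]
  exact integral_congr_ae (hR.ae_le (Lp.coeFn_neg (W : Lp ℝ ∞ P)))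

variable [IsProbabilityMeasure P]

/-- Claims `n 1_A (S_τ - S_σ)` with `A ∈ F_σ` have initial price `0`, so their `R`-means, linear in
`n ∈ ℤ`, are bounded by a finite number and must vanish. -/
theorem ExtendsDynamics.finitePenaltyLocalMartingale (hℱ : UsualAssumptions P ℱ) (hQ : Q.IsTCPP)
    {d : ℕ} {S : Fin (d + 1) → ℝ≥0 → Ω → ℝ} (hE : Q.ExtendsDynamics S) :
    Q.FinitePenaltyLocalMartingale S := by
  rintro R hR hRP hfin k τ ⟨x, hx⟩ σ hστ
  obtain ⟨B, hB⟩ := exists_bound_of_minimalPenalty_lt_top hℱ hQ hRP hfin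
  -- The case `n = 1` identifies `S_σ` with a price, which supplies its boundedness and
  -- measurability.
  obtain ⟨y, hy⟩ : ∃ y : LInf P σ, (y : Lp ℝ ∞ P) =ᵐ[P] valueAt (S k) σ :=
    ⟨_, by simpa using hE k 1 σ τ hστ x hx⟩
  have hprice (n : ℤ) : Q.price σ τ hστ ((n : ℝ) • x) = (n : ℝ) • y := by
    apply Subtype.ext
    apply Lp.ext
    filter_upwards [hE k n σ τ hστ x hx, Lp.coeFn_smul (n : ℝ) (y : Lp ℝ ∞ P), hy] with ω e1 e2 e3
    change _ = ((n : ℝ) • (y : Lp ℝ ∞ P) : Lp ℝ ∞ P) ω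
    rw [e1, e2, _root_.Pi.smul_apply, e3, smul_eq_mul]
  have hm : σ.2.measurableSpace ≤ mΩ := σ.2.measurableSpace_le
  have hkey (A : Set Ω) (hA : MeasurableSet[σ.2.measurableSpace] A) :
      ∫ ω in A, (x : Lp ℝ ∞ P) ω ∂(R) = ∫ ω in A, (y : Lp ℝ ∞ P) ω ∂(R) := by
    refine sub_eq_zero.1 (eq_zero_of_forall_int_mul_le (B := B) fun n => ?_)
    obtain ⟨W, hW⟩ := LInf.exists_indicator (IsStoppingTime.measurableSpace_mono σ.2 τ.2 hστ A hA)
      ((n : ℝ) • (x - LInf.incl hστ y))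
    rw [← integral_indicator_smul_sub hRP hστ (hm A hA) n hW]
    have h0 : Q.price σ τ hστ W = 0 := by
      have h1 := Q.price_indicator hστ hA hW
      rw [price_smul_sub, hprice, sub_self] at h1
      apply Subtype.ext
      apply Lp.ext
      have h2 : ((0 : LInf P σ) : Lp ℝ ∞ P) =ᵐ[P] 0 := Lp.coeFn_zero ℝ ∞ P
      filter_upwards [h1, h2] with ω e1 e2
      rw [e1]
      by_cases hω : ω ∈ A
      · rw [Set.indicator_of_mem hω]
      · rw [Set.indicator_of_notMem hω, e2]; rfl
    have h3 := hB τ W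
    rwa [← initialPrice_price hQ hστ, h0, initialPrice_zero, sub_zero] at h3
  have hy' := hRP.ae_le hy
  refine (condExp_congr_ae (hRP.ae_le hx.2.symm)).trans ?_
  refine EventuallyEq.trans ?_ hy'
  exact (ae_eq_condExp_of_forall_setIntegral_eq hm (integrable_of_ac hRP _)
    (fun s _ _ => (integrable_of_ac hRP _).integrableOn) (fun s hs _ => (hkey s hs).symm)
    ((mem_lpMeas_iff_aestronglyMeasurable.1 y.2).mono_ac hRP)).symm

theorem minimalPenalty_nonneg (hℱ : UsualAssumptions P ℱ) (τ : StopTime ℱ) {R : Measure Ω}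
    [IsProbabilityMeasure R] (hR : R ≪ P) : 0 ≤ Q.minimalPenalty τ R := by
  have h := le_minimalPenalty (Q := Q) hℱ τ hR 0
  have h0 : ∫ ω, ((0 : LInf P τ) : Lp ℝ ∞ P) ω ∂(R) = 0 :=
    integral_eq_zero_of_ae (hR.ae_le (Lp.coeFn_zero ℝ ∞ P))
  rwa [h0, initialPrice_zero, sub_zero, EReal.coe_zero] at h

/-- Testing the penalty at maturity `T l` on `-Y l` gives the bid bound, and on `Y l` the ask bound;
monotonicity in the maturity carries both to `τ`. -/
theorem IsCompatible.penaltyLowerBound (hℱ : UsualAssumptions P ℱ) (hQ : Q.IsTCPP) {p : ℕ}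
    {T : Fin p → StopTime ℱ} {Y : ∀ l, LInf P (T l)} {Cbid Cask : Fin p → ℝ}
    (hC : Q.IsCompatible T Y Cbid Cask) : Q.PenaltyLowerBound T Y Cbid Cask := by
  intro R hR hRP τ
  refine max_le (minimalPenalty_nonneg hℱ τ hRP) (iSup₂_le fun l hl => ?_)
  refine le_trans ?_ (minimalPenalty_mono hℱ hQ hl hRP)
  obtain ⟨ω, ⟨h1, -, h3⟩, h4, h5⟩ := ((hC l).and ((price_zero_ae (Q := Q) hℱ (T l) (Y l)).and
    (price_zero_ae (Q := Q) hℱ (T l) (-Y l)))).exists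
  rw [h5] at h1
  rw [h4] at h3
  rcases max_choice (Cbid l - ∫ ω, (Y l : Lp ℝ ∞ P) ω ∂(R))
    ((∫ ω, (Y l : Lp ℝ ∞ P) ω ∂(R)) - Cask l) with e | e <;> rw [e]
  · refine le_trans ?_ (le_minimalPenalty hℱ (T l) hRP (-Y l))
    rw [integral_neg_of_ac hRP]
    exact EReal.coe_le_coe_iff.2 (by linarith)
  · refine le_trans ?_ (le_minimalPenalty hℱ (T l) hRP (Y l))
    exact EReal.coe_le_coe_iff.2 (by linarith)

/-- If `Cask l < c` and `c` is below the price of `Y l`, the dual bound gives `R` with penalty at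
most `E_R(Y l) - c < E_R(Y l) - Cask l`, against the lower bound at maturity `∞`. The bid is the
same argument for `-Y l`. -/
theorem PenaltyLowerBound.isCompatible (hℱ : UsualAssumptions P ℱ) (hQ : Q.IsTCPP) {p : ℕ}
    {T : Fin p → StopTime ℱ} {Y : ∀ l, LInf P (T l)} {Cbid Cask : Fin p → ℝ}
    (hL : Q.PenaltyLowerBound T Y Cbid Cask) : Q.IsCompatible T Y Cbid Cask := by
  intro l
  have hlow (R : Measure Ω) (hR : IsProbabilityMeasure R) (hRP : R ≪ P) :
      ((max (Cbid l - ∫ ω, (Y l : Lp ℝ ∞ P) ω ∂(R))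
        ((∫ ω, (Y l : Lp ℝ ∞ P) ω ∂(R)) - Cask l) : ℝ) : EReal) ≤
        Q.minimalPenalty (StopTime.infty ℱ) R := by
    refine le_trans ?_ ((le_max_right _ _).trans (hL R hR hRP (StopTime.infty ℱ)))
    exact le_iSup₂_of_le l (StopTime.le_infty (T l)) le_rfl
  have hask : Q.initialPrice (T l) (Y l) ≤ Cask l := by
    by_contra! hlt
    obtain ⟨c, hc1, hc2⟩ := exists_between hlt
    obtain ⟨R, hR, hRP, hα⟩ := exists_minimalPenalty_le hℱ hQ (Y l) hc2
    have h1 := EReal.coe_le_coe_iff.1 ((hlow R hR hRP).trans hα)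
    linarith [(le_max_right _ _).trans h1]
  have hbid : Q.initialPrice (T l) (-Y l) ≤ -Cbid l := by
    by_contra! hlt
    obtain ⟨c, hc1, hc2⟩ := exists_between hlt
    obtain ⟨R, hR, hRP, hα⟩ := exists_minimalPenalty_le hℱ hQ (-Y l) hc2
    rw [integral_neg_of_ac hRP] at hα
    have h1 := EReal.coe_le_coe_iff.1 ((hlow R hR hRP).trans hα)
    linarith [(le_max_left _ _).trans h1]
  filter_upwards [price_zero_ae (Q := Q) hℱ (T l) (Y l), price_zero_ae (Q := Q) hℱ (T l) (-Y l),
    neg_price_neg_le (Q := Q) (StopTime.zero_le (T l)) (Y l)] with ω e1 e2 e3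
  refine ⟨?_, e3, ?_⟩
  · rw [e2]; linarith
  · rw [e1]; exact hask

theorem initialPrice_nonneg {τ : StopTime ℱ} {X : LInf P τ} (h : 0 ≤ (X : Lp ℝ ∞ P)) :
    0 ≤ Q.initialPrice τ X := by
  rw [← initialPrice_zero (Q := Q) τ]
  exact initialPrice_mono h

/-- Exhaustion over the measures of finite penalty. For `P A ≠ 0`, non degeneracy gives some `r 1_A`
a positive price, so the dual bound provides `R` with penalty at most `r R(A) - c` and `c > 0`.
Nonnegativity of the penalty forces `R A ≠ 0`. -/
theorem exists_equivalent_finitePenalty (hℱ : UsualAssumptions P ℱ) (hQ : Q.IsTCPP)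
    (hnd : Q.IsNonDegenerate) :
    ∃ R : Measure Ω, IsProbabilityMeasure R ∧ R ≪ P ∧ P ≪ R ∧
      Q.minimalPenalty (StopTime.infty ℱ) R < ⊤ := by
  let F : Set (Measure Ω) := {R | IsProbabilityMeasure R ∧ R ≪ P ∧
    Q.minimalPenalty (StopTime.infty ℱ) R < ⊤}
  suffices h : ∃ R ∈ F, P ≪ R by
    obtain ⟨R, ⟨h1, h2, h3⟩, h4⟩ := h
    exact ⟨R, h1, h2, h4, h3⟩
  refine exists_equivalent_of_dominating (fun R hR => ⟨hR.1, hR.2.1⟩) (fun R hR => ?_)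
    (fun A hA hPA => ?_)
  · have hb (n : ℕ) : ∃ B : ℝ, ∀ X : LInf P (StopTime.infty ℱ),
        ∫ ω, (X : Lp ℝ ∞ P) ω ∂(R n) - Q.initialPrice _ X ≤ B := by
      have := (hR n).1
      obtain ⟨B, hB⟩ := exists_bound_of_minimalPenalty_lt_top hℱ hQ (hR n).2.1 (hR n).2.2
      exact ⟨B, hB _⟩
    choose B hB using hb
    obtain ⟨M, hM, hMP, hRM, C, hC⟩ := exists_dominating_mixture
      (fun W => Q.initialPrice (StopTime.infty ℱ) ⟨W, hℱ.mem_LInf_infty W⟩) R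
      (fun n => (hR n).1) (fun n => (hR n).2.1) B (fun n Y => hB n ⟨Y, hℱ.mem_LInf_infty Y⟩)
    refine ⟨M, ⟨hM, hMP, ?_⟩, hRM⟩
    rw [minimalPenalty_eq hℱ _ hMP]
    exact (iSup_le fun X : LInf P (StopTime.infty ℱ) =>
      EReal.coe_le_coe_iff.2 (hC (X : Lp ℝ ∞ P))).trans_lt (EReal.coe_lt_top C)
  · have h := mt (hnd A hA) hPA
    push Not at h
    obtain ⟨r, hr, X, hX, hXne⟩ := h
    have hX0 : 0 ≤ (X : Lp ℝ ∞ P) := by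
      rw [← Lp.coeFn_nonneg]
      filter_upwards [hX] with ω e
      rw [e]
      exact Set.indicator_nonneg (fun _ _ => hr.le) ω
    have hpos : 0 < Q.initialPrice _ X := by
      refine lt_of_le_of_ne (initialPrice_nonneg hX0) fun h0 => hXne ?_
      apply Subtype.ext
      rw [price_zero_eq_const hℱ, ← h0, map_zero]
      rfl
    obtain ⟨c, hc0, hc⟩ := exists_between hpos
    obtain ⟨R, hR, hRP, hα⟩ := exists_minimalPenalty_le hℱ hQ X hc
    refine ⟨R, ⟨hR, hRP, hα.trans_lt (EReal.coe_lt_top _)⟩, fun hRA => ?_⟩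
    have h1 : ∫ ω, (X : Lp ℝ ∞ P) ω ∂(R) = 0 := by
      refine integral_eq_zero_of_ae ?_
      filter_upwards [hRP.ae_le hX, measure_eq_zero_iff_ae_notMem.1 hRA] with ω e1 e2
      rw [e1, Set.indicator_of_notMem e2]; rfl
    have h2 := (minimalPenalty_nonneg hℱ _ hRP).trans hα
    rw [h1] at h2
    have h3 : (0 : ℝ) ≤ 0 - c := by exact_mod_cast h2
    linarith

theorem FinitePenaltyLocalMartingale.extendsDynamics (hℱ : UsualAssumptions P ℱ) (hQ : Q.IsTCPP)
    (hnd : Q.IsNonDegenerate) {d : ℕ} {S : Fin (d + 1) → ℝ≥0 → Ω → ℝ}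
    (hM : Q.FinitePenaltyLocalMartingale S) : Q.ExtendsDynamics S := by
  intro k n σ τ hστ x hx
  have hm : σ.2.measurableSpace ≤ mΩ := σ.2.measurableSpace_le
  obtain ⟨y, hy⟩ : ∃ y : LInf P σ, (y : Lp ℝ ∞ P) =ᵐ[P] valueAt (S k) σ := by
    -- Under an equivalent `R` the identity `S_σ = E_R(S_τ | F_σ)` holds `P`-a.s., which makes `S_σ`
    -- bounded and `F_σ`-measurable up to null sets.
    obtain ⟨R, hR, hRP, hPR, hfin⟩ := exists_equivalent_finitePenalty hℱ hQ hnd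
    have h1 := hPR.ae_le (hM R hR hRP hfin k τ ⟨x, hx⟩ σ hστ)
    refine LInf.exists_of_bound σ (C := (‖(x : Lp ℝ ∞ P)‖₊ : ℝ))
      ⟨_, stronglyMeasurable_condExp, EventuallyEq.symm h1⟩ ?_
    have h2 : ∀ᵐ ω ∂(R), |valueAt (S k) τ ω| ≤ (‖(x : Lp ℝ ∞ P)‖₊ : ℝ) := by
      filter_upwards [hRP.ae_le hx.2, hRP.ae_le (Lp.ae_abs_le_norm_top (x : Lp ℝ ∞ P))]
        with ω e1 e2
      rwa [← e1]
    filter_upwards [h1, hPR.ae_le (ae_bdd_abs_condExp_of_ae_bdd_abs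
      (m := σ.2.measurableSpace) h2)] with ω e1 e2
    rwa [← e1]
  set D : LInf P τ := x - LInf.incl hστ y with hD
  -- A positive initial price would yield a measure of finite penalty; it is a local martingale
  -- measure, so `W` has mean `0` and its penalty would be at most `-b < 0`.
  have hlocal (A : Set Ω) (hA : MeasurableSet[σ.2.measurableSpace] A) (c : ℝ) (W : LInf P τ)
      (hW : (W : Lp ℝ ∞ P) =ᵐ[P] A.indicator ((c • D : LInf P τ) : Lp ℝ ∞ P)) :
      Q.initialPrice τ W ≤ 0 := by
    by_contra! hpos
    obtain ⟨b, hb0, hb⟩ := exists_between hpos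
    obtain ⟨R, hR, hRP, hα⟩ := exists_minimalPenalty_le hℱ hQ W hb
    have h1 := hM R hR hRP (hα.trans_lt (EReal.coe_lt_top _)) k τ ⟨x, hx⟩ σ hστ
    have h2 : ∫ ω in A, (x : Lp ℝ ∞ P) ω ∂(R) = ∫ ω in A, (y : Lp ℝ ∞ P) ω ∂(R) := by
      rw [integral_congr_ae (ae_restrict_of_ae (EventuallyEq.trans (hRP.ae_le hy) h1.symm)),
        setIntegral_condExp hm ((integrable_of_ac hRP _).congr (hRP.ae_le hx.2)) hA]
      exact integral_congr_ae (ae_restrict_of_ae (hRP.ae_le hx.2))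
    rw [integral_indicator_smul_sub hRP hστ (hm A hA) c hW, h2, sub_self, mul_zero] at hα
    have h3 : (0 : ℝ) ≤ 0 - b := by
      exact_mod_cast (minimalPenalty_nonneg hℱ _ hRP).trans hα
    linarith
  have hneg (c : ℝ) : ∀ᵐ ω ∂P, (Q.price σ τ hστ (c • D) : Lp ℝ ∞ P) ω ≤ 0 := by
    obtain ⟨g, hg, hZg⟩ := mem_lpMeas_iff_aestronglyMeasurable.1 (Q.price σ τ hστ (c • D)).2
    -- On `{g ≥ ε}` a large multiple `m` of the price exceeds `r`, so `r 1_A` is dominated by the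
    -- price at `σ` of `m c 1_A D`. By `hlocal` its initial price is then `0` for every `r`, and non
    -- degeneracy applies.
    have hnull (ε : ℝ) (hε : 0 < ε) : P {ω | ε ≤ g ω} = 0 := by
      have hA : MeasurableSet[σ.2.measurableSpace] {ω | ε ≤ g ω} :=
        hg.measurable measurableSet_Ici
      refine hnd _ (hm _ hA) fun r hr X hX => ?_
      obtain ⟨m, hmr⟩ := exists_nat_ge (max (r / ε) 1)
      have hm1 : (1 : ℝ) ≤ m := (le_max_right _ _).trans hmr
      have hmε : r ≤ m * ε := (div_le_iff₀ hε).1 ((le_max_left _ _).trans hmr)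
      obtain ⟨W, hW⟩ := LInf.exists_indicator
        (IsStoppingTime.measurableSpace_mono σ.2 τ.2 hστ _ hA) (((m : ℝ) * c) • D)
      have hV := Q.price_indicator hστ hA hW
      have hX0 : 0 ≤ (X : Lp ℝ ∞ P) := by
        rw [← Lp.coeFn_nonneg]
        filter_upwards [hX] with ω e
        rw [e]
        exact Set.indicator_nonneg (fun _ _ => hr.le) ω
      have hXV : (X : Lp ℝ ∞ P) ≤
          LInf.incl (StopTime.le_infty σ) (Q.price σ τ hστ W) := by
        change (X : Lp ℝ ∞ P) ≤ (Q.price σ τ hστ W : Lp ℝ ∞ P)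
        rw [← Lp.coeFn_le]
        have hmul := mul_price_le (Q := Q) hστ (c • D) hm1
        rw [smul_smul] at hmul
        filter_upwards [hX, hV, hmul, hZg] with ω e1 e2 e3 e4
        rw [e1, e2]
        by_cases hω : ω ∈ {ω | ε ≤ g ω}
        · rw [Set.indicator_of_mem hω, Set.indicator_of_mem hω]
          refine (hmε.trans ?_).trans e3
          rw [e4]
          exact mul_le_mul_of_nonneg_left hω (Nat.cast_nonneg m)
        · rw [Set.indicator_of_notMem hω, Set.indicator_of_notMem hω]
      have h1 := initialPrice_mono (Q := Q) hXV
      rw [initialPrice_incl hQ, initialPrice_price hQ] at h1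
      have h2 : Q.initialPrice _ X = 0 :=
        le_antisymm (h1.trans (hlocal _ hA _ W hW)) (initialPrice_nonneg hX0)
      apply Subtype.ext
      rw [price_zero_eq_const hℱ, h2, map_zero]
      rfl
    have hall : ∀ᵐ ω ∂P, ∀ j : ℕ, g ω < 1 / ((j : ℝ) + 1) := ae_all_iff.2 fun j => by
      filter_upwards [measure_eq_zero_iff_ae_notMem.1 (hnull (1 / ((j : ℝ) + 1)) (by positivity))]
        with ω hω
      exact not_le.1 hω
    filter_upwards [hall, hZg] with ω e1 e2
    rw [e2]
    by_contra! hpos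
    obtain ⟨j, hj⟩ := exists_nat_one_div_lt hpos
    exact lt_asymm hj (e1 j)
  have hprice := price_smul_sub (Q := Q) hστ (n : ℝ) x y
  rw [eq_sub_iff_add_eq] at hprice
  rw [← hprice, ← hD]
  -- The prices of `n • D` and `-(n • D)` are both nonpositive while their sum is nonnegative, so
  -- both vanish.
  filter_upwards [hneg n, hneg (-n), neg_price_neg_le (Q := Q) hστ ((n : ℝ) • D), hy,
    Lp.coeFn_add (Q.price σ τ hστ ((n : ℝ) • D) : Lp ℝ ∞ P) ((n : ℝ) • (y : Lp ℝ ∞ P)),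
    Lp.coeFn_smul (n : ℝ) (y : Lp ℝ ∞ P)] with ω e1 e2 e3 e4 e5 e6
  change ((Q.price σ τ hστ ((n : ℝ) • D) : Lp ℝ ∞ P) + (n : ℝ) • (y : Lp ℝ ∞ P) : Lp ℝ ∞ P) ω = _
  rw [neg_smul] at e2
  rw [e5, _root_.Pi.add_apply, e6, _root_.Pi.smul_apply, e4, smul_eq_mul]
  linarith

end DynamicPricingProcedure

end Admissibility

theorem mainTheorem11 {Ω : Type*} {mΩ : MeasurableSpace Ω} (P : Measure Ω)
    [IsProbabilityMeasure P] (ℱ : Filtration ℝ≥0 mΩ) (hℱ : UsualAssumptions P ℱ)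
    {d : ℕ} (S : Fin (d + 1) → ℝ≥0 → Ω → ℝ) (hS : IsReferenceMarket P ℱ S)
    {p : ℕ} (T : Fin p → StopTime ℱ) (Y : ∀ l, LInf P (T l)) (Cbid Cask : Fin p → ℝ)
    (Pi : DynamicPricingProcedure P ℱ) (hPi : Pi.IsTCPP) :
    (Pi.IsStronglyAdmissible S T Y Cbid Cask →
      Pi.FinitePenaltyLocalMartingale S ∧ Pi.PenaltyLowerBound T Y Cbid Cask) ∧
    (Pi.IsNonDegenerate →
      (Pi.IsStronglyAdmissible S T Y Cbid Cask ↔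
        Pi.FinitePenaltyLocalMartingale S ∧ Pi.PenaltyLowerBound T Y Cbid Cask)) := by
  have hfwd (h : Pi.IsStronglyAdmissible S T Y Cbid Cask) :
      Pi.FinitePenaltyLocalMartingale S ∧ Pi.PenaltyLowerBound T Y Cbid Cask :=
    ⟨h.extendsDynamics.finitePenaltyLocalMartingale hℱ hPi, h.compatible.penaltyLowerBound hℱ hPi⟩
  exact ⟨hfwd, fun hnd => ⟨hfwd, fun h =>
    ⟨h.1.extendsDynamics hℱ hPi hnd, h.2.isCompatible hℱ hPi⟩⟩⟩
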